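/- Let $\mathbf P_n$ be a convex $n$-gon with vertices labeled $1,\dots,n$ clockwise; indices are cyclic modulo $n$, $[a,b]=\{a,a+1,\dots,b\}$ denotes a cyclic interval, and $x_I=\sum_{a\in I}x_a$. A bicolored subdivision $\sigma$ of type $(k,n)$ is a partition of $\mathbf P_n$ into black and white polygons (with vertices among those of $\mathbf P_n$) such that polygons sharing an edge have different colors and any triangulation of the black polygons has exactly $k$ triangles. An arc $a\to b$ is compatible with $\sigma$ if it bounds or lies inside a polygon of $\sigma$; then $\mathrm{area}(a\to b)$ is the number of black triangles to its left in any triangulation of the black polygons. The arc is facet-defining if it bounds a black polygon of $\sigma$ to its left, and internal if it is not a boundary edge of $\mathbf P_n$. The tile of $\sigma$ is $$\Gamma_\sigma=\{x\in\mathbb R^n: x_{[1,n]}=k+1,\ \mathrm{area}(a\to b)\le x_{[a,b-1]}\le \mathrm{area}(a\to b)+1\text{ for all compatible arcs }a\to b\},$$ and for an internal facet-defining arc $i\to j$ of $\sigma$ let $\Gamma_\sigma^{(ij)}=\Gamma_\sigma\cap\{x_{[i,j-1]}=\mathrm{area}(i\to j)\}$. For a permutation $w=w_1\cdots w_n$,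 a cyclic descent is a letter $a$ such that $a$ occurs to the right of $a+1$ in $w$ (with $n+1:=1$). Let $D_{k+1,n}$ be the set of $w\in S_n$ with $k+1$ cyclic descents and $w_n=n$. Let $(w)$ be the cycle $w_1\mapsto w_2\mapsto\cdots\mapsto w_n\mapsto w_1$, let $I_r(w)$ be the set of cyclic descents of the cyclic rotation of $w$ ending at $r$, and let $\Delta_{(w)}$ be the convex hull of the $0/1$ vectors $e_{I_1(w)},\dots,e_{I_n(w)}$. If $i$ immediately precedes $j$ in $(w)$, with $j\ne i\pm1$, let $\Delta_{(w)}^{(ij)}$ be the common facet $\Delta_{(w)}\cap\Delta_{(u)}$, where $(u)$ is obtained from $(w)$ by swapping $i$ and $j$. Let $N_L=[i+1,j-1]\cup\{\star\}$ and $N_R=[j+1,i-1]\cup\{\star\}$, where $\star$ is the point obtained by identifying $i$ and $j$; let $(w_L)$ be the cycle on $N_L$ obtained from the subword of $w$ of letters in $[i,j]$ by identifying $i,j$ with $\star$, and $(w_R)$ the cycle on $N_R$ obtained likewise from the letters in $[j,i]$. For a word $u=u_1\cdots u_m$ on a label set $N$ let $$\mathrm{PT}(u)=\frac1{P_{u_1u_2}P_{u_2u_3}\cdots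 P_{u_mu_1}},$$ a rational function on the affine cone $\widehat{\mathrm{Gr}}_{2,N}$ over the real Grassmannian, where the $P_{ab}=-P_{ba}$ are the Plücker coordinates; it depends only on the cycle $(u)$. The weight function of $\Gamma_\sigma^{(ij)}$ is the rational function on $\widehat{\mathrm{Gr}}_{2,N_L}\times\widehat{\mathrm{Gr}}_{2,N_R}$ $$\Omega(\Gamma_\sigma^{(ij)})=\sum_{\Delta_{(w)}^{(ij)}\subset\Gamma_\sigma^{(ij)}}\mathrm{PT}(w_L)\,\mathrm{PT}(w_R),$$ where the sum is over the $w\in D_{k+1,n}$ such that $i$ immediately precedes $j$ in $(w)$ and $\Delta_{(w)}^{(ij)}\subset\Gamma_\sigma^{(ij)}$. **Proposition.** Let $\sigma$ be a bicolored subdivision of type $(k,n)$ and let $i\to j$ be an internal facet-defining arc of $\sigma$. Then $$\Omega(\Gamma_\sigma^{(ij)})=(-1)^{k-1}\binom{n-2}{|N_L|-1}\,\mathrm{PT}(\mathbf I_{N_L})\,\mathrm{PT}(\mathbf I_{N_R}),$$ where $\mathbf I_{N_L},\mathbf I_{N_R}$ are the identity permutations on $N_L,N_R$ (their elements in increasing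 order, $\star$ standing at the place of $i$ or $j$). In particular, for given $k$, $n$, $i$, $j$, the weight function $\Omega(\Gamma_\sigma^{(ij)})$ does not depend on $\sigma$. -/

import Mathlib

open scoped BigOperators

namespace ParkeTaylor

noncomputable section

/-! Vertices and letters `1, …, n` are modelled by `Fin n` (letter `a` is the element `a - 1`);
`+` and `-` in `Fin n` are modulo `n`, so `a + 1` is the clockwise successor of the vertex `a`. -/

/-! ### Cyclic intervals -/

/-- The cyclic interval `[i, j] = {i, i + 1, …, j}`. -/
def closedArc {n : ℕ} [NeZero n] (i j : Fin n) : Finset (Fin n) :=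
  Finset.univ.filter fun x => x - i ≤ j - i

/-- The cyclic interval `[i, j - 1] = {i, i + 1, …, j - 1}` (for `i ≠ j`). -/
def halfOpenArc {n : ℕ} [NeZero n] (i j : Fin n) : Finset (Fin n) :=
  Finset.univ.filter fun x => x - i < j - i

/-- The cyclic interval `[i + 1, j - 1]`, strictly between `i` and `j` (for `i ≠ j`). -/
def openArc {n : ℕ} [NeZero n] (i j : Fin n) : Finset (Fin n) :=
  Finset.univ.filter fun x => 0 < x - i ∧ x - i < j - i

/-! ### Bicolored subdivisions of the `n`-gon -/

/-- A polygon inscribed in the `n`-gon is given by its set `P` of vertices. `IsEdge P a b` says that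
`b` is the next vertex of `P` after `a` in clockwise order, so `a → b` is an edge of `P` and
`P` lies to the right of `a → b`, that is, to the left of `b → a`. -/
def IsEdge {n : ℕ} [NeZero n] (P : Finset (Fin n)) (a b : Fin n) : Prop :=
  a ∈ P ∧ b ∈ P ∧ a ≠ b ∧ Disjoint (openArc a b) P

/-- A bicolored subdivision: a partition of the convex `n`-gon, with vertices labelled clockwise,
into black and white polygons such that polygons that share an edge have different colors. -/
structure BicoloredSubdivision (n : ℕ) [NeZero n] where
  /-- the polygons of the subdivision, given by their sets of vertices -/
  polygons : Finset (Finset (Fin n))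
  /-- the black polygons; the other ones are white -/
  black : Finset (Finset (Fin n))
  black_subset : black ⊆ polygons
  three_le_card : ∀ P ∈ polygons, 3 ≤ P.card
  /-- Distinct polygons have disjoint interiors: an edge of `P` separates `Q` from `P`. -/
  interiors_disjoint : ∀ P ∈ polygons, ∀ Q ∈ polygons, P ≠ Q →
    ∃ a b, IsEdge P a b ∧ Q ⊆ closedArc a b
  /-- The polygons cover the `n`-gon: there is a polygon, and across every edge that is not a
  boundary edge of the `n`-gon lies another polygon. -/
  nonempty : polygons.Nonempty
  edge_glued : ∀ P ∈ polygons, ∀ a b, IsEdge P a b → b = a + 1 ∨ ∃ Q ∈ polygons, IsEdge Q b a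
  /-- Two polygons that share an edge have different colors. -/
  colors_alternate : ∀ P ∈ polygons, ∀ Q ∈ polygons, ∀ a b, IsEdge P a b → IsEdge Q b a →
    (P ∈ black ↔ Q ∉ black)

namespace BicoloredSubdivision

variable {n : ℕ} [NeZero n] (σ : BicoloredSubdivision n)

/-- The number of black triangles in any triangulation of the black polygons: a polygon with `r`
vertices is triangulated by `r - 2` triangles. The subdivision has type `(k, n)` if this is `k`. -/
def numBlackTriangles : ℕ := ∑ P ∈ σ.black, (P.card - 2)

/-- The arc `a → b` bounds a polygon of `σ` or lies inside one. -/
def IsCompatible (a b : Fin n) : Prop := a ≠ b ∧ ∃ P ∈ σ.polygons, a ∈ P ∧ b ∈ P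

/-- The area to the left of a compatible arc `a → b`: the number of black triangles to the left of
`a → b` in any triangulation of the black polygons. The vertices to the left of `a → b` or on it are
those in `[a, b]`, so the part of a black polygon `P` to the left is the polygon on `P ∩ [a, b]`
(empty, with truncated difference `0`, if this set has at most two elements). -/
def area (a b : Fin n) : ℕ := ∑ P ∈ σ.black, ((P ∩ closedArc a b).card - 2)

/-- The arc `i → j` is facet-defining: it bounds a black polygon to its left. -/
def IsFacetDefining (i j : Fin n) : Prop := ∃ P ∈ σ.black, IsEdge P j i

end BicoloredSubdivision

/-- The arc `i → j` is internal: it is not a boundary edge of the `n`-gon. -/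
def IsInternal {n : ℕ} [NeZero n] (i j : Fin n) : Prop := i ≠ j ∧ j ≠ i + 1 ∧ i ≠ j + 1

/-! ### Tiles of the hypersimplex and their facets -/

/-- The tile of the hypersimplex `Δ_{k+1,n}` that corresponds to `σ` of type `(k, n)`. -/
def tile {n : ℕ} [NeZero n] (σ : BicoloredSubdivision n) : Set (Fin n → ℝ) :=
  {x | ∑ a, x a = (σ.numBlackTriangles : ℝ) + 1 ∧
    ∀ a b, σ.IsCompatible a b →
      (σ.area a b : ℝ) ≤ ∑ c ∈ halfOpenArc a b, x c ∧
      ∑ c ∈ halfOpenArc a b, x c ≤ (σ.area a b : ℝ) + 1}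

/-- The facet of the tile of `σ` on the hyperplane `x_{[i, j-1]} = area (i → j)`, for a
facet-defining arc `i → j`. -/
def tileFacet {n : ℕ} [NeZero n] (σ : BicoloredSubdivision n) (i j : Fin n) :
    Set (Fin n → ℝ) :=
  {x | x ∈ tile σ ∧ ∑ c ∈ halfOpenArc i j, x c = (σ.area i j : ℝ)}

/-! ### `w`-simplices -/

/-! A permutation `w` is the word `w 0, w 1, …, w (n - 1)`, so `w.symm a` is the position of the
letter `a`. -/

/-- Cyclic (left) descents: `a` occurs to the right of `a + 1` (where `a + 1` is the first letter
if `a` is the last one). -/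
def cDes {n : ℕ} [NeZero n] (w : Equiv.Perm (Fin n)) : Finset (Fin n) :=
  Finset.univ.filter fun a => w.symm (a + 1) < w.symm a

/-- The cyclic rotation of the word `w` that ends at the letter `a`. -/
def rotateTo {n : ℕ} [NeZero n] (w : Equiv.Perm (Fin n)) (a : Fin n) : Equiv.Perm (Fin n) :=
  (Equiv.addRight (w.symm a + 1)).trans w

/-- The 0/1 vector `e_I`. -/
def indicatorVec {n : ℕ} (I : Finset (Fin n)) : Fin n → ℝ := fun a => if a ∈ I then 1 else 0

/-- The `w`-simplex: the convex hull of the points `e_{I_r}`, where `I_r` is the set of cyclic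
descents of the rotation of `w` ending at `r`. It depends only on the cycle `(w)`. -/
def wSimplex {n : ℕ} [NeZero n] (w : Equiv.Perm (Fin n)) : Set (Fin n → ℝ) :=
  convexHull ℝ (Set.range fun r => indicatorVec (cDes (rotateTo w r)))

/-- The set `D_{k+1,n}` of permutations with `k + 1` cyclic descents whose last letter is the
largest one; each cycle `(w)` comes from exactly one permutation of this form. -/
def descentClass (k n : ℕ) [NeZero n] : Set (Equiv.Perm (Fin n)) :=
  {w | (cDes w).card = k + 1 ∧ w (Fin.rev 0) = Fin.rev 0}

/-- The letter `i` immediately precedes `j` in the cycle `(w)`. -/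
def Precedes {n : ℕ} [NeZero n] (w : Equiv.Perm (Fin n)) (i j : Fin n) : Prop :=
  w (w.symm i + 1) = j

/-- For `i` immediately preceding `j` in `(w)` and `j ≠ i ± 1`: the common facet of the `w`-simplices
of `w = (A i j B)` and of `u = (A j i B)`, the latter obtained by swapping the letters `i` and `j`. -/
def wFacet {n : ℕ} [NeZero n] (w : Equiv.Perm (Fin n)) (i j : Fin n) : Set (Fin n → ℝ) :=
  wSimplex w ∩ wSimplex (w.trans (Equiv.swap i j))

/-! ### The label sets on the two sides of an arc -/

/-- The set `[i + 1, j - 1] ∪ {⋆}`, where `⋆ = none` is the point obtained by identifying `i` and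
`j`. It is `N_L` for the arc `i → j`, and `Side j i` is `N_R`. -/
abbrev Side {n : ℕ} [NeZero n] (i j : Fin n) : Type := Option {a : Fin n // a ∈ openArc i j}

/-- On `[i, j]`: the identification of `i` and `j` with `⋆`. -/
def toSide {n : ℕ} [NeZero n] (i j : Fin n) (a : Fin n) : Side i j :=
  if h : a ∈ openArc i j then some ⟨a, h⟩ else none

/-- The subword of `l` of the letters in `[i, j]`, with `i` and `j` identified with `⋆` and the
repeated letter `⋆` written once. (Used when `i` and `j` are neighbours in that subword, up to cyclic
rotation.) -/
def sideWord {n : ℕ} [NeZero n] (i j : Fin n) (l : List (Fin n)) : List (Side i j) :=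
  ((l.filter fun a => a ∈ closedArc i j).map (toSide i j)).dedup

/-- The identity permutation on `Side i j`, as a word: `⋆` and the elements of `[i + 1, j - 1]` in
the order inherited from the word `1 2 … n`. -/
def identityWord {n : ℕ} [NeZero n] (i j : Fin n) : List (Side i j) :=
  sideWord i j (List.finRange n)

/-! ### Rational functions on the product of two cones over Grassmannians of planes -/

/-- The `2 × 2` minor of columns `a`, `b` of a generic `2`-row matrix with columns labelled by `N`. -/
def genericMinor {N : Type} (a b : N) : MvPolynomial (Fin 2 × N) ℝ :=
  MvPolynomial.X (0, a) * MvPolynomial.X (1, b) - MvPolynomial.X (1, a) * MvPolynomial.X (0, b)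

/-- The coordinate ring of the product of the affine cones over the real Grassmannians `Gr_{2,L}` and
`Gr_{2,R}`: the algebra generated by the minors of a generic `2 × L` matrix and the minors of a
generic `2 × R` matrix. -/
def coneRing (L R : Type) : Subalgebra ℝ (MvPolynomial (Fin 2 × (L ⊕ R)) ℝ) :=
  Algebra.adjoin ℝ
    ({p | ∃ a b : L, p = genericMinor (Sum.inl a) (Sum.inl b)} ∪
      {p | ∃ a b : R, p = genericMinor (Sum.inr a) (Sum.inr b)})

theorem genericMinor_inl_mem {L R : Type} (a b : L) :
    (genericMinor (Sum.inl a) (Sum.inl b) : MvPolynomial (Fin 2 × (L ⊕ R)) ℝ) ∈ coneRing L R :=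
  Algebra.subset_adjoin (Or.inl ⟨a, b, rfl⟩)

theorem genericMinor_inr_mem {L R : Type} (a b : R) :
    (genericMinor (Sum.inr a) (Sum.inr b) : MvPolynomial (Fin 2 × (L ⊕ R)) ℝ) ∈ coneRing L R :=
  Algebra.subset_adjoin (Or.inr ⟨a, b, rfl⟩)

/-- The field of rational functions on the product of the affine cones over `Gr_{2,L}` and
`Gr_{2,R}`. -/
abbrev RatFun (L R : Type) : Type := FractionRing (coneRing L R)

/-- The Plücker coordinate `P_{ab}` of the first factor. -/
def pluckerL {L R : Type} (a b : L) : RatFun L R :=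
  algebraMap (coneRing L R) (RatFun L R)
    ⟨genericMinor (Sum.inl a) (Sum.inl b), genericMinor_inl_mem a b⟩

/-- The Plücker coordinate `P_{ab}` of the second factor. -/
def pluckerR {L R : Type} (a b : R) : RatFun L R :=
  algebraMap (coneRing L R) (RatFun L R)
    ⟨genericMinor (Sum.inr a) (Sum.inr b), genericMinor_inr_mem a b⟩

/-- The Parke–Taylor function `1 / (P_{u₁u₂} P_{u₂u₃} ⋯ P_{u_mu₁})` of a word `u` without repeated
letters, in the Plücker coordinates `P`. It depends only on the cycle `(u)`. -/
def PT {N F : Type} [Field F] (P : N → N → F) (u : List N) : F :=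
  1 / (List.zipWith P u (u.rotate 1)).prod

/-- The weight function `PT(w_L) PT(w_R)` of the facet `wFacet w i j`. -/
def wFacetWeight {n : ℕ} [NeZero n] (w : Equiv.Perm (Fin n)) (i j : Fin n) :
    RatFun (Side i j) (Side j i) :=
  PT pluckerL (sideWord i j (List.ofFn w)) * PT pluckerR (sideWord j i (List.ofFn w))

open Classical in
/-- The weight function of the facet `tileFacet σ i j`, for an internal facet-defining arc `i → j`:
the sum of the weight functions of the facets `wFacet w i j` (where `i` immediately precedes
`j` in `(w)`) that are contained in it. -/
def tileFacetWeight {n : ℕ} [NeZero n] (σ : BicoloredSubdivision n) (i j : Fin n) :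
    RatFun (Side i j) (Side j i) :=
  ∑ w : Equiv.Perm (Fin n) with w ∈ descentClass σ.numBlackTriangles n ∧ Precedes w i j ∧
    wFacet w i j ⊆ tileFacet σ i j, wFacetWeight w i j

end

end ParkeTaylor

namespace ParkeTaylor

noncomputable section

/-! Call $(w)$ compatible with $\sigma$ if the vertices of every white polygon occur in it clockwise
and those of every black polygon counterclockwise. The proof translates the facet condition into
compatibility and then sums Parke–Taylor functions over compatible cycles.

Facets. Following the letters $a,a+1,\dots,b$ forward through a word read cyclically, one passes the
end of the word once for each descent in $[a,b-1]$. Going directly from $a$ to $b$ passes it once if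
$b$ precedes $a$ and not at all otherwise. The detour $a\to q\to b$ passes it one extra time exactly
if $a,b,q$ is the cyclic order in the word (`inv01_add`), which for a triangle with $q\in[a,b]$
means that it is counterclockwise. Cutting along triangles, $(w)$ is compatible iff each compatible
arc $a\to b$ has area$(a\to b)$ descents, plus one if $b$ precedes $a$. These are the two values
that the tile allows, so for $i$ immediately before $j$ the facet lies in the tile facet iff $(w)$
is compatible (`facet_condition_iff`).

Sums. Let a letter $b$ be inserted in a word in all places cyclically between $a$ and $c$. By the
Plücker relation the Parke–Taylor functions telescope to the old one times $P_{ac}/(P_{ab}P_{bc})$;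
for the complementary places the sign changes (`sum_insertAt_inv_chainProd`). Building up a side of
the arc triangle by triangle, the diagonals cancel, the boundary edges stay in the denominator, and
each black triangle gives $-1$ (`sum_oriented`).

Assembly. No polygon crosses $i\to j$, so compatibility is a condition on $w_L$ and one on $w_R$.
Cutting the cycle between $i$ and $j$ gives a word $j\,v\,i$, where $v$ is any shuffle of the words
of the two sides; this is the binomial coefficient (`sum_words_union`). On each side the place of
the triangle at the arc is forced, so it gives no sign. It is black on the left and white on the
right, so the sign is that of $k-1$ black triangles (`sum_oriented_side`). -/

/-! ### Cyclic order -/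

/-- Three natural numbers in cyclic order. -/
def CycOrd (a b c : ℕ) : Prop := (a < b ∧ b < c) ∨ (b < c ∧ c < a) ∨ (c < a ∧ a < b)

section Arcs

theorem val_sub_eq {n : ℕ} (x i : Fin n) :
    (x - i).val = if i.val ≤ x.val then x.val - i.val else n + x.val - i.val := by
  have hx := x.isLt
  have hi := i.isLt
  rw [Fin.sub_def]
  simp only
  split_ifs with h
  · rw [show n - i.val + x.val = (x.val - i.val) + n by omega, Nat.add_mod_right,
      Nat.mod_eq_of_lt (by omega)]
  · rw [Nat.mod_eq_of_lt (by omega)]; omega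

variable {n : ℕ} [NeZero n]

theorem val_add_one (x : Fin n) :
    (x + 1).val = if x.val + 1 = n then 0 else x.val + 1 := by
  have hx := x.isLt
  rw [Fin.val_add, Fin.val_one']
  rcases Nat.lt_or_ge 1 n with h | h
  · rw [Nat.mod_eq_of_lt h]
    split_ifs with h1
    · rw [h1, Nat.mod_self]
    · exact Nat.mod_eq_of_lt (by omega)
  · have : n = 1 := by omega
    subst this
    split_ifs <;> omega

theorem mem_openArc {i j x : Fin n} : x ∈ openArc i j ↔ CycOrd i.val x.val j.val := by
  have := x.isLt; have := i.isLt; have := j.isLt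
  simp only [openArc, Finset.mem_filter, Finset.mem_univ, true_and, Fin.lt_def, val_sub_eq,
    Fin.val_zero, CycOrd]
  split_ifs <;> omega

theorem mem_closedArc {i j x : Fin n} : x ∈ closedArc i j ↔
    (i.val ≤ x.val ∧ x.val ≤ j.val) ∨ (j.val < i.val ∧ (i.val ≤ x.val ∨ x.val ≤ j.val)) := by
  have := x.isLt; have := i.isLt; have := j.isLt
  simp only [closedArc, Finset.mem_filter, Finset.mem_univ, true_and, Fin.le_def, val_sub_eq]
  split_ifs <;> omega

theorem mem_halfOpenArc {i j x : Fin n} : x ∈ halfOpenArc i j ↔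
    (i.val ≤ x.val ∧ x.val < j.val) ∨ (j.val < i.val ∧ (i.val ≤ x.val ∨ x.val < j.val)) := by
  have := x.isLt; have := i.isLt; have := j.isLt
  simp only [halfOpenArc, Finset.mem_filter, Finset.mem_univ, true_and, Fin.lt_def, val_sub_eq]
  split_ifs <;> omega

theorem openArc_succ (a : Fin n) : openArc a (a + 1) = ∅ := by
  ext x
  have := x.isLt; have := a.isLt
  simp only [mem_openArc, CycOrd, val_add_one, Finset.notMem_empty, iff_false]
  split_ifs <;> omega

theorem halfOpenArc_succ {a : Fin n} (h : a ≠ a + 1) : halfOpenArc a (a + 1) = {a} := by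
  ext x
  have := x.isLt; have := a.isLt
  have h : a.val ≠ (a + 1).val := fun h' => h (Fin.ext h')
  simp only [mem_halfOpenArc, Finset.mem_singleton, Fin.ext_iff]
  rw [val_add_one] at h ⊢
  split_ifs at h ⊢ <;> omega

theorem halfOpenArc_split {a p b : Fin n} (h : p ∈ openArc a b) :
    Disjoint (halfOpenArc a p) (halfOpenArc p b) ∧
      halfOpenArc a b = halfOpenArc a p ∪ halfOpenArc p b := by
  rw [mem_openArc, CycOrd] at h
  constructor
  · rw [Finset.disjoint_left]
    intro x
    simp only [mem_halfOpenArc]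
    omega
  · ext x
    simp only [Finset.mem_union, mem_halfOpenArc]
    omega

theorem halfOpenArc_compl {a b : Fin n} (h : a ≠ b) :
    Disjoint (halfOpenArc a b) (halfOpenArc b a) ∧
      halfOpenArc a b ∪ halfOpenArc b a = Finset.univ := by
  have h' : a.val ≠ b.val := fun h' => h (Fin.ext h')
  constructor
  · rw [Finset.disjoint_left]
    intro x
    simp only [mem_halfOpenArc]
    omega
  · ext x
    simp only [Finset.mem_union, mem_halfOpenArc, Finset.mem_univ, iff_true]
    omega

theorem arc_length_lt {a p b : Fin n} (h : p ∈ openArc a b) :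
    (p - a).val < (b - a).val ∧ (b - p).val < (b - a).val := by
  have := a.isLt; have := b.isLt; have := p.isLt
  rw [mem_openArc, CycOrd] at h
  rw [val_sub_eq, val_sub_eq, val_sub_eq]
  split_ifs <;> omega

end Arcs

/-! ### Bicolored subdivisions: splitting an arc -/

namespace BicoloredSubdivision

variable {n : ℕ} [NeZero n] (σ : BicoloredSubdivision n)

theorem IsEdge.not_mem {Q : Finset (Fin n)} {c d x : Fin n} (h : IsEdge Q c d) (hx : x ∈ Q) :
    ¬ CycOrd c.val x.val d.val := fun h' =>
  Finset.disjoint_left.mp h.2.2.2 (mem_openArc.mpr h') hx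

/-- A compatible arc is a boundary arc or is split by a vertex of a polygon. -/
theorem exists_split {a b : Fin n} (h : σ.IsCompatible a b) :
    b = a + 1 ∨ ∃ Q ∈ σ.polygons, ∃ p, a ∈ Q ∧ p ∈ Q ∧ b ∈ Q ∧ p ∈ openArc a b := by
  obtain ⟨hab, Q, hQ, ha, hb⟩ := h
  by_cases hd : Disjoint (openArc a b) Q
  -- If `Q` has no vertex strictly between `a` and `b`, then `a → b` is an edge of `Q`, and the
  -- polygon across it has its further vertices there.
  · rcases σ.edge_glued Q hQ a b ⟨ha, hb, hab, hd⟩ with h | ⟨R, hR, hE⟩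
    · exact Or.inl h
    · right
      obtain ⟨p, hp, hpa, hpb⟩ : ∃ p ∈ R, p ≠ a ∧ p ≠ b := by
        have h3 := σ.three_le_card R hR
        obtain ⟨p, hp, hp'⟩ := Finset.exists_mem_notMem_of_card_lt_card
          (s := {a, b}) (t := R) (lt_of_le_of_lt (Finset.card_le_two) (by omega))
        simp only [Finset.mem_insert, Finset.mem_singleton, not_or] at hp'
        exact ⟨p, hp, hp'.1, hp'.2⟩
      refine ⟨R, hR, p, hE.2.1, hp, hE.1, ?_⟩
      have h1 := IsEdge.not_mem hE hp
      rw [mem_openArc]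
      have := Fin.val_ne_of_ne hpa
      have := Fin.val_ne_of_ne hpb
      have := Fin.val_ne_of_ne hab
      unfold CycOrd at *
      omega
  · right
    rw [Finset.not_disjoint_iff] at hd
    obtain ⟨p, hp, hpQ⟩ := hd
    exact ⟨Q, hQ, p, ha, hpQ, hb, hp⟩

/-- A polygon other than `Q` lies in one of the three arcs cut out by three vertices of `Q`. -/
theorem polygon_location {Q R : Finset (Fin n)} (hQ : Q ∈ σ.polygons) (hR : R ∈ σ.polygons)
    (hne : Q ≠ R) {a p b : Fin n} (ha : a ∈ Q) (hp : p ∈ Q) (hb : b ∈ Q) (h : p ∈ openArc a b) :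
    R ⊆ closedArc a p ∨ R ⊆ closedArc p b ∨ R ⊆ closedArc b a := by
  obtain ⟨c, d, hE, hsub⟩ := σ.interiors_disjoint Q hQ R hR hne
  have h1 := IsEdge.not_mem hE ha
  have h2 := IsEdge.not_mem hE hp
  have h3 := IsEdge.not_mem hE hb
  have h4 : c.val ≠ d.val := Fin.val_ne_of_ne hE.2.2.1
  rw [mem_openArc] at h
  -- None of `a`, `p`, `b` lies strictly inside the arc cut off by the separating edge, so this arc
  -- fits into one of the three.
  have key : closedArc c d ⊆ closedArc a p ∨ closedArc c d ⊆ closedArc p b ∨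
      closedArc c d ⊆ closedArc b a := by
    have : (c ∈ closedArc a p ∧ d ∈ closedArc a p ∧ c ≠ p) ∨
      (c ∈ closedArc p b ∧ d ∈ closedArc p b ∧ c ≠ b) ∨
      (c ∈ closedArc b a ∧ d ∈ closedArc b a ∧ c ≠ a) := by
      simp only [mem_closedArc, ne_eq, Fin.ext_iff]
      unfold CycOrd at *
      omega
    rcases this with ⟨hc, hd, hcp⟩ | ⟨hc, hd, hcp⟩ | ⟨hc, hd, hcp⟩
    · left
      intro x hx
      simp only [mem_closedArc, ne_eq, Fin.ext_iff] at *
      unfold CycOrd at *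
      omega
    · right; left
      intro x hx
      simp only [mem_closedArc, ne_eq, Fin.ext_iff] at *
      unfold CycOrd at *
      omega
    · right; right
      intro x hx
      simp only [mem_closedArc, ne_eq, Fin.ext_iff] at *
      unfold CycOrd at *
      omega
  rcases key with k | k | k
  · exact Or.inl (hsub.trans k)
  · exact Or.inr (Or.inl (hsub.trans k))
  · exact Or.inr (Or.inr (hsub.trans k))

/-- Cutting `Q ∩ [a, b]` at `p` counts `p` twice, and subtracting `2` from both parts loses exactly
the triangle `a p b`. Any other polygon lies in a single one of the three arcs of `polygon_location`
and meets the other parts in at most two points. -/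
theorem area_split {Q : Finset (Fin n)} (hQ : Q ∈ σ.polygons) {a p b : Fin n}
    (ha : a ∈ Q) (hp : p ∈ Q) (hb : b ∈ Q) (h : p ∈ openArc a b) :
    σ.area a b = σ.area a p + σ.area p b + if Q ∈ σ.black then 1 else 0 := by
  have hone : (if Q ∈ σ.black then 1 else 0) = ∑ R ∈ σ.black, if R = Q then 1 else 0 := by
    rw [Finset.sum_ite_eq']
  rw [hone, area, area, area, ← Finset.sum_add_distrib, ← Finset.sum_add_distrib]
  refine Finset.sum_congr rfl fun R hR => ?_
  have hcyc := mem_openArc.mp h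
  split_ifs with hRQ
  · subst hRQ
    have hpi : (R ∩ closedArc a p) ∩ (R ∩ closedArc p b) = {p} := by
      ext x
      simp only [Finset.mem_inter, mem_closedArc, Finset.mem_singleton]
      constructor
      · rintro ⟨⟨_, h1⟩, _, h2⟩
        apply Fin.ext
        unfold CycOrd at *
        omega
      · rintro rfl
        unfold CycOrd at *
        refine ⟨⟨hp, ?_⟩, hp, ?_⟩ <;> omega
    have hun : (R ∩ closedArc a p) ∪ (R ∩ closedArc p b) = R ∩ closedArc a b := by
      rw [← Finset.inter_union_distrib_left]
      congr 1
      ext x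
      simp only [Finset.mem_union, mem_closedArc]
      unfold CycOrd at *
      omega
    have hc := Finset.card_union_add_card_inter (R ∩ closedArc a p) (R ∩ closedArc p b)
    rw [hpi, hun, Finset.card_singleton] at hc
    -- Each part contains both ends of its arc, so no subtraction of `2` is truncated.
    have two : ∀ x y : Fin n, x ∈ R → y ∈ R → x ≠ y → 2 ≤ (R ∩ closedArc x y).card := by
      intro x y hx hy hxy
      rw [← Finset.card_pair hxy]
      refine Finset.card_le_card ?_
      intro z hz
      simp only [Finset.mem_insert, Finset.mem_singleton] at hz
      rw [Finset.mem_inter, mem_closedArc]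
      rcases hz with rfl | rfl
      · exact ⟨hx, by omega⟩
      · exact ⟨hy, by omega⟩
    have hap : a ≠ p := by rintro rfl; unfold CycOrd at *; omega
    have hpb : p ≠ b := by rintro rfl; unfold CycOrd at *; omega
    have h1 := two a p ha hp hap
    have h2 := two p b hp hb hpb
    omega
  · have small : ∀ (S : Finset (Fin n)) (x y : Fin n), S ⊆ {x, y} → S.card - 2 = 0 := by
      intro S x y hS
      have := (Finset.card_le_card hS).trans (Finset.card_le_two)
      omega
    rcases σ.polygon_location hQ (σ.black_subset hR) (Ne.symm hRQ) ha hp hb h with hl | hl | hl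
    · have e1 : R ∩ closedArc a b = R ∩ closedArc a p := by
        ext x
        simp only [Finset.mem_inter]
        refine and_congr_right fun hx => ?_
        have := hl hx
        simp only [mem_closedArc] at *
        unfold CycOrd at *
        omega
      have e2 : (R ∩ closedArc p b).card - 2 = 0 := by
        refine small _ p p ?_
        intro x hx
        rw [Finset.mem_inter] at hx
        have := hl hx.1
        have := hx.2
        simp only [Finset.mem_insert, Finset.mem_singleton, Fin.ext_iff]
        simp only [mem_closedArc] at *
        unfold CycOrd at *
        omega
      rw [e1, e2, add_zero, add_zero]
    · have e1 : R ∩ closedArc a b = R ∩ closedArc p b := by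
        ext x
        simp only [Finset.mem_inter]
        refine and_congr_right fun hx => ?_
        have := hl hx
        simp only [mem_closedArc] at *
        unfold CycOrd at *
        omega
      have e2 : (R ∩ closedArc a p).card - 2 = 0 := by
        refine small _ p p ?_
        intro x hx
        rw [Finset.mem_inter] at hx
        have := hl hx.1
        have := hx.2
        simp only [Finset.mem_insert, Finset.mem_singleton, Fin.ext_iff]
        simp only [mem_closedArc] at *
        unfold CycOrd at *
        omega
      rw [e1, e2, zero_add, add_zero]
    · have e : ∀ c d : Fin n, closedArc c d ⊆ closedArc a b → (R ∩ closedArc c d).card - 2 = 0 := by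
        intro c d hcd
        refine small _ a b ?_
        intro x hx
        rw [Finset.mem_inter] at hx
        have := hl hx.1
        have := hcd hx.2
        simp only [Finset.mem_insert, Finset.mem_singleton, Fin.ext_iff]
        simp only [mem_closedArc] at *
        unfold CycOrd at *
        omega
      rw [e a b subset_rfl, e a p ?_, e p b ?_]
      all_goals
        intro x hx
        simp only [mem_closedArc] at *
        unfold CycOrd at *
        omega

theorem area_succ (a : Fin n) : σ.area a (a + 1) = 0 := by
  refine Finset.sum_eq_zero fun R _ => ?_
  have : (R ∩ closedArc a (a + 1)) ⊆ {a, a + 1} := by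
    intro x hx
    have h := (Finset.mem_inter.mp hx).2
    have := x.isLt; have := a.isLt
    simp only [Finset.mem_insert, Finset.mem_singleton, Fin.ext_iff]
    rw [mem_closedArc] at h
    rw [val_add_one] at *
    split_ifs at * <;> omega
  have := (Finset.card_le_card this).trans Finset.card_le_two
  omega

/-- The edge of `P` that separates `Q` is either `j → i` itself, with `Q` beyond it, or another
edge, whose outer arc stays within `[i, j]`. -/
theorem polygon_side {P Q : Finset (Fin n)} (hP : P ∈ σ.polygons) (hQ : Q ∈ σ.polygons)
    {i j : Fin n} (hE : IsEdge P j i) : Q ⊆ closedArc i j ∨ Q ⊆ closedArc j i := by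
  have hPs : P ⊆ closedArc i j := by
    intro x hx
    have := IsEdge.not_mem hE hx
    have := Fin.val_ne_of_ne hE.2.2.1
    rw [mem_closedArc]
    unfold CycOrd at *
    omega
  by_cases hPQ : P = Q
  · exact Or.inl (hPQ ▸ hPs)
  obtain ⟨c, d, hcd, hs⟩ := σ.interiors_disjoint P hP Q hQ hPQ
  by_cases hc : c = j
  · subst hc
    have : d = i := by
      have h1 := IsEdge.not_mem hcd hE.2.1
      have h2 := IsEdge.not_mem hE hcd.2.1
      have h3 := Fin.val_ne_of_ne hcd.2.2.1
      have h4 := Fin.val_ne_of_ne hE.2.2.1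
      apply Fin.ext
      unfold CycOrd at *
      omega
    subst this
    exact Or.inr hs
  · left
    intro x hx
    have hx := hs hx
    have h1 := hPs hcd.1
    have h2 := hPs hcd.2.1
    have h3 := IsEdge.not_mem hcd hE.1
    have h4 := IsEdge.not_mem hcd hE.2.1
    have h5 := Fin.val_ne_of_ne hcd.2.2.1
    have h6 := Fin.val_ne_of_ne hc
    simp only [mem_closedArc] at *
    unfold CycOrd at *
    omega

theorem area_add_area {P : Finset (Fin n)} (hP : P ∈ σ.polygons)
    {i j : Fin n} (hE : IsEdge P j i) : σ.area i j + σ.area j i = σ.numBlackTriangles := by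
  rw [area, area, numBlackTriangles, ← Finset.sum_add_distrib]
  refine Finset.sum_congr rfl fun R hR => ?_
  have hne := Fin.val_ne_of_ne hE.2.2.1
  have aux : ∀ x y : Fin n, x.val ≠ y.val → R ⊆ closedArc x y →
      (R ∩ closedArc x y).card - 2 + ((R ∩ closedArc y x).card - 2) = R.card - 2 := by
    intro x y hxy hs
    have : R ∩ closedArc y x ⊆ {x, y} := by
      intro z hz
      rw [Finset.mem_inter] at hz
      have h1 := hs hz.1
      have h2 := hz.2
      simp only [Finset.mem_insert, Finset.mem_singleton, Fin.ext_iff]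
      simp only [mem_closedArc] at *
      omega
    have := (Finset.card_le_card this).trans Finset.card_le_two
    rw [Finset.inter_eq_left.mpr hs]
    omega
  rcases σ.polygon_side hP (σ.black_subset hR) hE with h | h
  · exact aux i j hne.symm h
  · rw [add_comm]; exact aux j i hne h

/-! ### Compatibility of a word with the subdivision -/

/-- The letters of each white polygon in the arc appear clockwise, those of each black polygon
counterclockwise; `pos` gives the positions of the letters. -/
def Oriented (x y : Fin n) (pos : Fin n → ℕ) : Prop :=
  ∀ Q ∈ σ.polygons, ∀ a ∈ Q, ∀ m ∈ Q, ∀ b ∈ Q,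
    a ∈ closedArc x y → m ∈ closedArc x y → b ∈ closedArc x y → CycOrd a.val m.val b.val →
      (CycOrd (pos a) (pos b) (pos m) ↔ Q ∈ σ.black)

/-- As `Oriented`, for all polygons. -/
def OrientedAll (pos : Fin n → ℕ) : Prop :=
  ∀ Q ∈ σ.polygons, ∀ a ∈ Q, ∀ m ∈ Q, ∀ b ∈ Q, CycOrd a.val m.val b.val →
      (CycOrd (pos a) (pos b) (pos m) ↔ Q ∈ σ.black)

/-- This decouples the two sides of the arc: no polygon has vertices strictly on both sides. -/
theorem orientedAll_iff {P : Finset (Fin n)} (hP : P ∈ σ.polygons)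
    {i j : Fin n} (hE : IsEdge P j i) (pos : Fin n → ℕ) :
    σ.OrientedAll pos ↔ σ.Oriented i j pos ∧ σ.Oriented j i pos := by
  constructor
  · intro h
    exact ⟨fun Q hQ a ha m hm b hb _ _ _ => h Q hQ a ha m hm b hb,
      fun Q hQ a ha m hm b hb _ _ _ => h Q hQ a ha m hm b hb⟩
  · rintro ⟨h1, h2⟩ Q hQ a ha m hm b hb
    rcases σ.polygon_side hP hQ hE with h | h
    · exact h1 Q hQ a ha m hm b hb (h ha) (h hm) (h hb)
    · exact h2 Q hQ a ha m hm b hb (h ha) (h hm) (h hb)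

theorem oriented_succ (x : Fin n) (pos : Fin n → ℕ) : σ.Oriented x (x + 1) pos := by
  intro Q _ a _ m _ b _ ha hm hb h
  exfalso
  have := a.isLt; have := b.isLt; have := m.isLt; have := x.isLt
  rw [mem_closedArc] at ha hm hb
  rw [val_add_one] at *
  unfold CycOrd at *
  split_ifs at * <;> omega

end BicoloredSubdivision

/-! ### Words on a finite set of letters: restriction and insertion -/

section Words

variable {α : Type*} [DecidableEq α]

/-- The words in which each letter of `A` occurs exactly once. -/
def words (A : Finset α) : Finset (List α) := A.toList.permutations.toFinset

theorem mem_words {A : Finset α} {l : List α} : l ∈ words A ↔ l.Nodup ∧ l.toFinset = A := by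
  rw [words, List.mem_toFinset, List.mem_permutations]
  constructor
  · intro h
    exact ⟨h.nodup_iff.mpr A.nodup_toList,
      by rw [List.toFinset_eq_of_perm _ _ h, Finset.toList_toFinset]⟩
  · rintro ⟨h, rfl⟩
    exact (List.toFinset_toList h).symm

theorem mem_of_mem_words {A : Finset α} {l : List α} (h : l ∈ words A) {x : α} :
    x ∈ l ↔ x ∈ A := by
  rw [← (mem_words.mp h).2, List.mem_toFinset]

theorem filter_mem_words {A B : Finset α} (h : A ⊆ B) {l : List α} (hl : l ∈ words B) :
    l.filter (· ∈ A) ∈ words A := by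
  rw [mem_words]
  refine ⟨(mem_words.mp hl).1.filter _, ?_⟩
  ext x
  simp only [List.mem_toFinset, List.mem_filter, decide_eq_true_eq, mem_of_mem_words hl]
  exact ⟨fun h => h.2, fun hx => ⟨h hx, hx⟩⟩

theorem filter_filter_mem {A B : Finset α} (h : A ⊆ B) (l : List α) :
    (l.filter (· ∈ B)).filter (· ∈ A) = l.filter (· ∈ A) := by
  rw [List.filter_filter]
  refine List.filter_congr fun x _ => ?_
  by_cases hx : x ∈ A
  · simp [hx, h hx]
  · simp [hx]

/-- Lets letters be added in batches: a condition that involves only the letters of `B` is settled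
before those of `C` outside `B` are inserted. -/
theorem sum_words_fiber {M : Type*} [AddCommMonoid M] {A B C : Finset α} (hAB : A ⊆ B)
    (hBC : B ⊆ C) (u : List α) (c₁ c₂ : List α → Prop) [DecidablePred c₁] [DecidablePred c₂]
    (f : List α → M) :
    ∑ v ∈ words C with v.filter (· ∈ A) = u ∧ c₁ (v.filter (· ∈ B)) ∧ c₂ v, f v =
      ∑ v₁ ∈ words B with v₁.filter (· ∈ A) = u ∧ c₁ v₁,
        ∑ v ∈ words C with v.filter (· ∈ B) = v₁ ∧ c₂ v, f v := by
  rw [← Finset.sum_fiberwise_of_maps_to (g := fun v : List α => v.filter (· ∈ B))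
    (t := (words B).filter fun v₁ => v₁.filter (· ∈ A) = u ∧ c₁ v₁)]
  · refine Finset.sum_congr rfl fun v₁ hv₁ => Finset.sum_congr ?_ fun _ _ => rfl
    ext v
    simp only [Finset.mem_filter] at hv₁ ⊢
    constructor
    · rintro ⟨⟨h1, _, _, h4⟩, h5⟩
      exact ⟨h1, h5, h4⟩
    · rintro ⟨h1, rfl, h3⟩
      rw [filter_filter_mem hAB] at hv₁
      exact ⟨⟨h1, hv₁.2.1, hv₁.2.2, h3⟩, rfl⟩
  · intro v hv
    simp only [Finset.mem_filter] at hv ⊢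
    rw [filter_filter_mem hAB]
    exact ⟨filter_mem_words hBC hv.1, hv.2.1, hv.2.2.1⟩

/-- The word `l` with the letter `b` inserted at position `k`. -/
def insertAt (k : ℕ) (b : α) (l : List α) : List α := l.take k ++ b :: l.drop k

omit [DecidableEq α] in
theorem insertAt_succ_cons (k : ℕ) (b x : α) (l : List α) :
    insertAt (k + 1) b (x :: l) = x :: insertAt k b l := by simp [insertAt]

omit [DecidableEq α] in
theorem insertAt_append {k : ℕ} (b : α) {l : List α} (h : k ≤ l.length) (l' : List α) :
    insertAt k b l ++ l' = insertAt k b (l ++ l') := by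
  simp [insertAt, List.take_append_of_le_length h, List.drop_append_of_le_length h]

theorem idxOf_insertAt_self {b : α} : ∀ {k : ℕ} {l : List α}, b ∉ l → k ≤ l.length →
    (insertAt k b l).idxOf b = k
  | 0, l, _, _ => by simp [insertAt]
  | k + 1, [], _, h => by simp at h
  | k + 1, x :: l, hb, h => by
      rw [List.mem_cons, not_or] at hb
      rw [insertAt_succ_cons, List.idxOf_cons_ne _ (Ne.symm hb.1),
        idxOf_insertAt_self hb.2 (by simpa using h)]

theorem idxOf_insertAt_of_ne {b x : α} (hx : x ≠ b) : ∀ {k : ℕ} {l : List α}, k ≤ l.length →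
    (insertAt k b l).idxOf x = if l.idxOf x < k then l.idxOf x else l.idxOf x + 1
  | 0, l, _ => by simp [insertAt, List.idxOf_cons_ne _ (Ne.symm hx)]
  | k + 1, [], h => by simp at h
  | k + 1, y :: l, h => by
      rw [insertAt_succ_cons]
      by_cases hxy : y = x
      · subst hxy; simp
      · rw [List.idxOf_cons_ne _ hxy, List.idxOf_cons_ne _ hxy,
          idxOf_insertAt_of_ne hx (by simpa using h)]
        split_ifs <;> omega

theorem sum_words_insert {M : Type*} [AddCommMonoid M] {A : Finset α} {b : α} (hb : b ∉ A)
    {u : List α} (hu : u ∈ words A) (c : List α → Prop) [DecidablePred c] (f : List α → M) :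
    ∑ v ∈ words (insert b A) with v.filter (· ∈ A) = u ∧ c v, f v =
      ∑ k ∈ Finset.range (u.length + 1) with c (insertAt k b u), f (insertAt k b u) := by
  symm
  have hbu : b ∉ u := fun h => hb ((mem_of_mem_words hu).mp h)
  refine Finset.sum_bij (fun k _ => insertAt k b u) ?_ ?_ ?_ (fun _ _ => rfl)
  · intro k hk
    simp only [Finset.mem_filter, Finset.mem_range] at hk ⊢
    refine ⟨mem_words.mpr ⟨?_, ?_⟩, ?_, hk.2⟩
    · rw [insertAt, List.nodup_middle, List.take_append_drop]
      exact List.nodup_cons.mpr ⟨hbu, (mem_words.mp hu).1⟩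
    · rw [insertAt, List.toFinset_eq_of_perm _ _ List.perm_middle, List.take_append_drop,
        List.toFinset_cons, (mem_words.mp hu).2]
    · rw [insertAt, List.filter_append, List.filter_cons_of_neg (by simpa using hb),
        ← List.filter_append, List.take_append_drop]
      exact List.filter_eq_self.mpr fun x hx => by simpa using (mem_of_mem_words hu).mp hx
  · intro k hk k' hk' h
    simp only [Finset.mem_filter, Finset.mem_range] at hk hk'
    have h := congrArg (List.idxOf b) h
    simpa only [idxOf_insertAt_self hbu (Nat.lt_succ_iff.mp hk.1),
      idxOf_insertAt_self hbu (Nat.lt_succ_iff.mp hk'.1)] using h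
  · intro v hv
    simp only [Finset.mem_filter] at hv
    obtain ⟨hv, hvu, hc⟩ := hv
    obtain ⟨s, t, rfl⟩ := List.append_of_mem ((mem_of_mem_words hv).mpr (Finset.mem_insert_self b A))
    have hnd := (mem_words.mp hv).1
    rw [List.nodup_middle, List.nodup_cons] at hnd
    have hst : s ++ t = u := by
      rw [← hvu, List.filter_append, List.filter_cons_of_neg (by simpa using hb),
        ← List.filter_append]
      symm
      refine List.filter_eq_self.mpr fun x hx => ?_
      have hx' : x ∈ insert b A := (mem_of_mem_words hv).mp (by
        simp only [List.mem_append, List.mem_cons] at hx ⊢; tauto)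
      rcases Finset.mem_insert.mp hx' with rfl | h
      · exact absurd hx hnd.1
      · simpa using h
    have hins : insertAt s.length b u = s ++ b :: t := by
      rw [← hst, insertAt, List.take_left, List.drop_left]
    refine ⟨s.length, ?_, hins⟩
    rw [Finset.mem_filter, Finset.mem_range, hins, ← hst, List.length_append]
    exact ⟨by omega, hc⟩

/-- Relative order survives deletion of other letters; hence orientation conditions may be tested on
restrictions of a word. -/
theorem idxOf_filter_lt {q : α → Bool} {x y : α} (hx : q x = true) (hy : q y = true) :
    ∀ l : List α, (l.filter q).idxOf x < (l.filter q).idxOf y ↔ l.idxOf x < l.idxOf y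
  | [] => by simp
  | z :: l => by
      have ih := idxOf_filter_lt hx hy l
      by_cases hz : q z = true
      · rw [List.filter_cons_of_pos hz]
        by_cases h1 : z = x
        · subst h1
          by_cases h2 : z = y
          · subst h2; simp
          · simp [List.idxOf_cons_ne _ h2]
        · by_cases h2 : z = y
          · subst h2; simp
          · simpa [List.idxOf_cons_ne _ h1, List.idxOf_cons_ne _ h2] using ih
      · rw [List.filter_cons_of_neg hz]
        have h1 : z ≠ x := by rintro rfl; exact hz hx
        have h2 : z ≠ y := by rintro rfl; exact hz hy
        simpa [List.idxOf_cons_ne _ h1, List.idxOf_cons_ne _ h2] using ih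

end Words

/-! ### Products over neighbouring letters and the insertion identity -/

section Chain

variable {α F : Type*} [Field F]

/-- The product `p x₁ x₂ * p x₂ x₃ * ⋯` over the neighbours in a word. -/
def chainProd (p : α → α → F) (l : List α) : F := (List.zipWith p l l.tail).prod

theorem chainProd_cons_cons (p : α → α → F) (x y : α) (l : List α) :
    chainProd p (x :: y :: l) = p x y * chainProd p (y :: l) := by
  simp [chainProd]

theorem chainProd_append (p : α → α → F) (x : α) (t : List α) : ∀ s : List α,
    chainProd p (s ++ x :: t) = chainProd p (s ++ [x]) * chainProd p (x :: t)
  | [] => by simp [chainProd]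
  | [y] => by simp [chainProd]
  | y :: z :: s => by
      have := chainProd_append p x t (z :: s)
      simp only [List.cons_append, chainProd_cons_cons] at this ⊢
      rw [this, mul_assoc]

/-- Only the factor at the gap after `l[k]` is replaced. The form without division needs no
nonvanishing. -/
theorem chainProd_insertAt (p : α → α → F) (b : α) (l : List α) (k : ℕ) (hk : k + 1 < l.length) :
    chainProd p (insertAt (k + 1) b l) * p l[k] l[k + 1] =
      chainProd p l * (p l[k] b * p b l[k + 1]) := by
  have h1 : l.take (k + 1) = l.take k ++ [l[k]] := by simp
  have h2 : l.drop (k + 1) = l[k + 1] :: l.drop (k + 2) := List.drop_eq_getElem_cons hk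
  have h3 : l = l.take k ++ l[k] :: l[k + 1] :: l.drop (k + 2) := by
    conv_lhs => rw [← List.take_append_drop (k + 1) l, h1, h2]
    simp
  have h4 : insertAt (k + 1) b l = l.take k ++ l[k] :: b :: l[k + 1] :: l.drop (k + 2) := by
    rw [insertAt, h1, h2, List.append_assoc, List.singleton_append]
  have h5 := congrArg (chainProd p) h3
  rw [chainProd_append] at h5
  rw [h4, h5, chainProd_append]
  simp only [chainProd_cons_cons]
  ring

theorem chainProd_ne_zero_iff (p : α → α → F) (l : List α) :
    chainProd p l ≠ 0 ↔ l.IsChain fun x y => p x y ≠ 0 := by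
  induction l with
  | nil => simp [chainProd]
  | cons x l ih =>
    cases l with
    | nil => simp [chainProd]
    | cons y l => rw [chainProd_cons_cons, mul_ne_zero_iff, ih, List.isChain_cons_cons]

variable [DecidableEq α]

open Classical in
/-- The sum over all ways of inserting a letter `b` in the cyclic order prescribed by `a` and `c`. -/
theorem sum_insertAt_inv_chainProd (p : α → α → F) (hanti : ∀ x y, p x y = -p y x)
    (hpl : ∀ x y z t, p x y * p z t - p x z * p y t + p x t * p y z = 0)
    {s t a b c : α} {u : List α} (hss : p s s = 0) (hts : p t s = 0)
    (ha : a ∈ s :: (u ++ [t])) (hc : c ∈ s :: (u ++ [t])) (hac : a ≠ c)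
    (hb : b ∉ s :: (u ++ [t])) (hne : ∀ x ∈ s :: (u ++ [t]), p x b ≠ 0)
    (hch : chainProd p (s :: (u ++ [t])) ≠ 0) (B : Prop) [Decidable B] :
    ∑ k ∈ Finset.range (u.length + 1) with
        (CycOrd ((s :: (insertAt k b u ++ [t])).idxOf a) ((s :: (insertAt k b u ++ [t])).idxOf c)
          ((s :: (insertAt k b u ++ [t])).idxOf b) ↔ B),
        (chainProd p (s :: (insertAt k b u ++ [t])))⁻¹ =
      (if B then -1 else 1) * (p a c / (p a b * p b c)) * (chainProd p (s :: (u ++ [t])))⁻¹ := by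
  set l := s :: (u ++ [t]) with hl
  have hlen : l.length = u.length + 2 := by simp [hl]
  have hins : ∀ k ≤ u.length, s :: (insertAt k b u ++ [t]) = insertAt (k + 1) b l := by
    intro k hk
    rw [insertAt_append b hk, hl, insertAt_succ_cons]
  -- By the Plücker relation for `x, y, b, s`, the factor `p x y / (p x b * p b y)` produced by an
  -- insertion between `x` and `y` is `g x - g y`, so sums over consecutive gaps telescope.
  set g : α → F := fun x => p x s / (p x b * p b s) with hg
  have hbs : p b s ≠ 0 := by
    rw [hanti]; exact neg_ne_zero.mpr (hne s (by simp [hl]))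
  have hgsub : ∀ x y, p x b ≠ 0 → p y b ≠ 0 → g x - g y = p x y / (p x b * p b y) := by
    intro x y hx hy
    have h := hpl x y b s
    rw [hanti b y]
    simp only [hg]
    field_simp
    linear_combination h
  -- The default `s` is never reached: only indices within the word are evaluated.
  set G : ℕ → F := fun k => g (l.getD k s) with hG
  have hGidx : ∀ x ∈ l, G (l.idxOf x) = g x := by
    intro x hx
    simp only [hG]
    rw [List.getD_eq_getElem _ _ (List.idxOf_lt_length_iff.mpr hx), List.getElem_idxOf]
  have hterm : ∀ k ∈ Finset.range (u.length + 1),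
      (chainProd p (s :: (insertAt k b u ++ [t])))⁻¹ =
        (chainProd p l)⁻¹ * (G k - G (k + 1)) := by
    intro k hk
    rw [Finset.mem_range] at hk
    have hk2 : k + 1 < l.length := by omega
    rw [hins k (by omega)]
    have h1 := chainProd_insertAt p b l k hk2
    simp only [hG]
    rw [List.getD_eq_getElem _ _ (show k < l.length by omega), List.getD_eq_getElem _ _ hk2]
    have e1 : p l[k] b ≠ 0 := hne _ (List.getElem_mem _)
    have e2 : p l[k + 1] b ≠ 0 := hne _ (List.getElem_mem _)
    have e3 : p b l[k + 1] ≠ 0 := by rw [hanti]; exact neg_ne_zero.mpr e2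
    have e4 : p l[k] l[k + 1] ≠ 0 :=
      List.isChain_iff_getElem.mp ((chainProd_ne_zero_iff p l).mp hch) k hk2
    rw [hgsub _ _ e1 e2]
    have e5 : chainProd p (insertAt (k + 1) b l) ≠ 0 := by
      intro h0
      rw [h0, zero_mul] at h1
      exact mul_ne_zero hch (mul_ne_zero e1 e3) h1.symm
    field_simp
    linear_combination -h1
  have hposb : ∀ k ∈ Finset.range (u.length + 1),
      (s :: (insertAt k b u ++ [t])).idxOf b = k + 1 := by
    intro k hk
    rw [Finset.mem_range] at hk
    rw [hins k (by omega), idxOf_insertAt_self hb (by omega)]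
  have hpos : ∀ x ∈ l, ∀ k ∈ Finset.range (u.length + 1),
      (s :: (insertAt k b u ++ [t])).idxOf x =
        if l.idxOf x < k + 1 then l.idxOf x else l.idxOf x + 1 := by
    intro x hx k hk
    rw [Finset.mem_range] at hk
    rw [hins k (by omega), idxOf_insertAt_of_ne (by rintro rfl; exact hb hx) (by omega)]
  have hia : l.idxOf a < u.length + 2 := hlen ▸ List.idxOf_lt_length_iff.mpr ha
  have hic : l.idxOf c < u.length + 2 := hlen ▸ List.idxOf_lt_length_iff.mpr hc
  have hiac : l.idxOf a ≠ l.idxOf c := fun h => hac (List.idxOf_inj ha |>.mp h)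
  have htel : ∀ x y : ℕ, x ≤ y → ∑ k ∈ Finset.Ico x y, (G k - G (k + 1)) = G x - G y := by
    intro x y hxy
    induction y, hxy using Nat.le_induction with
    | base => simp
    | succ y hy ih => rw [Finset.sum_Ico_succ_top hy, ih]; ring
  -- Over all gaps the sum is `g s - g t`, and both terms vanish because `p s s = p t s = 0`.
  have htot : ∑ k ∈ Finset.range (u.length + 1), (G k - G (k + 1)) = 0 := by
    rw [Finset.range_eq_Ico, htel _ _ (Nat.zero_le _)]
    have h0 : G 0 = 0 := by simp [hG, hl, hg, hss]
    have h1 : G (u.length + 1) = 0 := by simp [hG, hl, hg, hts]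
    rw [h0, h1, sub_zero]
  -- The gaps cyclically after `c` and before `a`. If they wrap around the end of the word, the
  -- complementary interval is summed and `htot` is used.
  have hblack : ∑ k ∈ Finset.range (u.length + 1) with
      CycOrd ((s :: (insertAt k b u ++ [t])).idxOf a) ((s :: (insertAt k b u ++ [t])).idxOf c)
          ((s :: (insertAt k b u ++ [t])).idxOf b), (G k - G (k + 1)) = g c - g a := by
    have hcond : ∀ k ∈ Finset.range (u.length + 1),
        (CycOrd ((s :: (insertAt k b u ++ [t])).idxOf a) ((s :: (insertAt k b u ++ [t])).idxOf c)
          ((s :: (insertAt k b u ++ [t])).idxOf b) ↔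
        (l.idxOf c ≤ k ∧ k < l.idxOf a) ∨ (l.idxOf a < l.idxOf c ∧ ¬ (l.idxOf a ≤ k ∧ k < l.idxOf c))) := by
      intro k hk
      rw [hposb k hk, hpos a ha k hk, hpos c hc k hk]
      unfold CycOrd
      split_ifs <;> omega
    rw [Finset.filter_congr hcond]
    rcases lt_or_gt_of_ne hiac with h | h
    · have h1 := Finset.sum_filter_add_sum_filter_not (Finset.range (u.length + 1))
        (fun k => l.idxOf a ≤ k ∧ k < l.idxOf c) (fun k => G k - G (k + 1))
      have e1 : (Finset.range (u.length + 1)).filter (fun k => l.idxOf a ≤ k ∧ k < l.idxOf c) =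
          Finset.Ico (l.idxOf a) (l.idxOf c) := by
        ext k; simp only [Finset.mem_filter, Finset.mem_range, Finset.mem_Ico]; omega
      rw [htot, e1, htel _ _ h.le, hGidx a ha, hGidx c hc] at h1
      rw [← sub_eq_zero, ← h1]
      have e2 : (Finset.range (u.length + 1)).filter (fun k => (l.idxOf c ≤ k ∧ k < l.idxOf a) ∨
            (l.idxOf a < l.idxOf c ∧ ¬ (l.idxOf a ≤ k ∧ k < l.idxOf c))) =
          (Finset.range (u.length + 1)).filter (fun k => ¬ (l.idxOf a ≤ k ∧ k < l.idxOf c)) := by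
        ext k; simp only [Finset.mem_filter, Finset.mem_range]; omega
      rw [e2]; ring
    · have e1 : (Finset.range (u.length + 1)).filter (fun k => (l.idxOf c ≤ k ∧ k < l.idxOf a) ∨
            (l.idxOf a < l.idxOf c ∧ ¬ (l.idxOf a ≤ k ∧ k < l.idxOf c))) =
          Finset.Ico (l.idxOf c) (l.idxOf a) := by
        ext k; simp only [Finset.mem_filter, Finset.mem_range, Finset.mem_Ico]; omega
      rw [e1, htel _ _ h.le, hGidx a ha, hGidx c hc]
  rw [Finset.sum_congr rfl fun k hk => hterm k (Finset.mem_of_mem_filter k hk), ← Finset.mul_sum]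
  have hgac := hgsub a c (hne a ha) (hne c hc)
  by_cases hB : B
  · simp only [hB, iff_true, if_true]
    rw [hblack, ← hgac]; ring
  · simp only [hB, iff_false, if_false]
    have h1 := Finset.sum_filter_add_sum_filter_not (Finset.range (u.length + 1))
      (fun k => CycOrd ((s :: (insertAt k b u ++ [t])).idxOf a)
        ((s :: (insertAt k b u ++ [t])).idxOf c) ((s :: (insertAt k b u ++ [t])).idxOf b))
      (fun k => G k - G (k + 1))
    rw [htot, hblack] at h1
    rw [eq_neg_of_add_eq_zero_right h1, ← hgac]; ring

end Chain

/-! ### Cyclic orders and gluing of orientations along a diagonal -/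

theorem CycOrd.not_iff {a b c : ℕ} (h1 : a ≠ b) (h2 : b ≠ c) (h3 : a ≠ c) :
    ¬ CycOrd a b c ↔ CycOrd a c b := by
  unfold CycOrd; omega

theorem CycOrd.rotate {a b c : ℕ} (h : CycOrd a b c) : CycOrd b c a := by
  unfold CycOrd at *; omega

theorem CycOrd.trans {a b c d : ℕ} (h : CycOrd a b c) (h' : CycOrd a c d) :
    CycOrd a b d ∧ CycOrd b c d := by
  unfold CycOrd at *; omega

theorem CycOrd.ne {a b c : ℕ} (h : CycOrd a b c) : a ≠ b ∧ b ≠ c ∧ a ≠ c := by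
  unfold CycOrd at *; omega

section

variable {n : ℕ} [NeZero n]

omit [NeZero n] in
theorem cycOrd_sub (x a b c : Fin n) :
    CycOrd (a - x).val (b - x).val (c - x).val ↔ CycOrd a.val b.val c.val := by
  have := a.isLt; have := b.isLt; have := c.isLt; have := x.isLt
  simp only [val_sub_eq]
  unfold CycOrd
  split_ifs <;> omega

theorem mem_closedArc_iff_sub (x : Fin n) {a b z : Fin n} : z ∈ closedArc a b ↔
    ((a - x).val ≤ (z - x).val ∧ (z - x).val ≤ (b - x).val) ∨
      ((b - x).val < (a - x).val ∧
        ((a - x).val ≤ (z - x).val ∨ (z - x).val ≤ (b - x).val)) := by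
  have := a.isLt; have := b.isLt; have := z.isLt; have := x.isLt
  rw [mem_closedArc]
  simp only [val_sub_eq]
  split_ifs <;> omega

/-- A cyclic orientation that is clockwise on two adjacent arcs and on the triangle that they span
is clockwise on their union. -/
theorem glue_orientation {O : Fin n → Fin n → Fin n → Prop} {S : Finset (Fin n)}
    (hrot : ∀ a b c, O a b c → O b c a)
    (htrans : ∀ a b c d, O a b c → O a c d → O a b d ∧ O b c d)
    {x p y : Fin n} (hx : x ∈ S) (hp : p ∈ S) (hy : y ∈ S) (hxpy : p ∈ openArc x y)
    (hO : O x p y)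
    (h₁ : ∀ a ∈ S, ∀ m ∈ S, ∀ b ∈ S, a ∈ closedArc x p → m ∈ closedArc x p → b ∈ closedArc x p →
      CycOrd a.val m.val b.val → O a m b)
    (h₂ : ∀ a ∈ S, ∀ m ∈ S, ∀ b ∈ S, a ∈ closedArc p y → m ∈ closedArc p y → b ∈ closedArc p y →
      CycOrd a.val m.val b.val → O a m b)
    {a m b : Fin n} (ha : a ∈ S) (hm : m ∈ S) (hb : b ∈ S) (ha' : a ∈ closedArc x y)
    (hm' : m ∈ closedArc x y) (hb' : b ∈ closedArc x y) (h : CycOrd a.val m.val b.val) :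
    O a m b := by
  -- Measuring all positions from `x` turns the cyclic order on `[x, y]` into a linear one.
  have hd : ∀ z w, (z - x).val = (w - x).val → z = w := fun z w h => sub_left_injective (Fin.ext h)
  have hx0 : (x - x).val = 0 := by simp
  have hpy : (x - x).val < (p - x).val ∧ (p - x).val < (y - x).val := by
    rw [mem_openArc, ← cycOrd_sub x, CycOrd] at hxpy
    omega
  have c₁ : ∀ z, (z - x).val ≤ (p - x).val → z ∈ closedArc x p := fun z hz => by
    rw [mem_closedArc_iff_sub x]; omega
  have c₂ : ∀ z, (p - x).val ≤ (z - x).val → (z - x).val ≤ (y - x).val → z ∈ closedArc p y :=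
    fun z hz hz' => by rw [mem_closedArc_iff_sub x]; omega
  have lin : ∀ {a b c : Fin n}, (a - x).val < (b - x).val → (b - x).val < (c - x).val →
      CycOrd a.val b.val c.val := fun h h' => (cycOrd_sub x _ _ _).mp (Or.inl ⟨h, h'⟩)
  -- The triangle `x p y` is moved to any `c p z` with `c` before and `z` after `p`: here `y` is
  -- replaced by `z`, in `E2` also `x` by `c`.
  have E1 : ∀ z ∈ S, (p - x).val < (z - x).val → (z - x).val ≤ (y - x).val → O x p z := by
    intro z hz h1 h2
    rcases h2.lt_or_eq with h2 | h2
    · have := h₂ p hp z hz y hy (c₂ _ le_rfl (by omega)) (c₂ _ h1.le h2.le)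
        (c₂ _ (by omega) le_rfl) (lin h1 h2)
      exact hrot _ _ _ (hrot _ _ _ (htrans _ _ _ _ this (hrot _ _ _ hO)).1)
    · rw [hd z y h2]; exact hO
  have E2 : ∀ c ∈ S, ∀ z ∈ S, (c - x).val < (p - x).val → (p - x).val < (z - x).val →
      (z - x).val ≤ (y - x).val → O c p z := by
    intro c hc z hz h0 h1 h2
    rcases Nat.eq_zero_or_pos (c - x).val with h | h
    · rw [hd c x (h.trans hx0.symm)]; exact E1 z hz h1 h2
    · have := h₁ x hx c hc p hp (c₁ _ (by omega)) (c₁ _ h0.le) (c₁ _ le_rfl)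
        (lin (by omega) h0)
      exact (htrans _ _ _ _ this (E1 z hz h1 h2)).2
  -- When `a` and `b` lie on different sides of `p`, the triangle `a p b` is compared with the
  -- triangle on the side of `m` by transitivity.
  have key : ∀ a m b : Fin n, a ∈ S → m ∈ S → b ∈ S → (a - x).val < (m - x).val →
      (m - x).val < (b - x).val → (b - x).val ≤ (y - x).val → O a m b := by
    intro a m b ha hm hb h1 h2 h3
    rcases le_or_gt (b - x).val (p - x).val with hbp | hbp
    · exact h₁ a ha m hm b hb (c₁ _ (by omega)) (c₁ _ (by omega)) (c₁ _ hbp) (lin h1 h2)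
    rcases le_or_gt (p - x).val (a - x).val with hap | hap
    · exact h₂ a ha m hm b hb (c₂ _ hap (by omega)) (c₂ _ (by omega) (by omega))
        (c₂ _ (by omega) h3) (lin h1 h2)
    have hapb : O a p b := E2 a ha b hb hap hbp h3
    rcases lt_trichotomy (m - x).val (p - x).val with hmp | hmp | hmp
    · have := h₁ a ha m hm p hp (c₁ _ hap.le) (c₁ _ hmp.le) (c₁ _ le_rfl) (lin h1 hmp)
      exact (htrans _ _ _ _ this hapb).1
    · rw [hd m p hmp]; exact hapb
    · have := h₂ p hp m hm b hb (c₂ _ le_rfl (by omega)) (c₂ _ hmp.le (by omega))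
        (c₂ _ hbp.le h3) (lin hmp h2)
      exact hrot _ _ _ (hrot _ _ _ (htrans _ _ _ _ this (hrot _ _ _ hapb)).2)
  rw [mem_closedArc_iff_sub x] at ha' hm' hb'
  rw [← cycOrd_sub x] at h
  rcases h with ⟨h1, h2⟩ | ⟨h1, h2⟩ | ⟨h1, h2⟩
  · exact key a m b ha hm hb h1 h2 (by omega)
  · exact hrot _ _ _ (hrot _ _ _ (key m b a hm hb ha h1 h2 (by omega)))
  · exact hrot _ _ _ (key b a m hb ha hm h1 h2 (by omega))

namespace BicoloredSubdivision

variable (σ : BicoloredSubdivision n)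

theorem Oriented.mono {σ : BicoloredSubdivision n} {x y x' y' : Fin n} {pos : Fin n → ℕ}
    (h : σ.Oriented x y pos) (hs : closedArc x' y' ⊆ closedArc x y) : σ.Oriented x' y' pos :=
  fun Q hQ a ha m hm b hb h1 h2 h3 => h Q hQ a ha m hm b hb (hs h1) (hs h2) (hs h3)

theorem Oriented.congr {σ : BicoloredSubdivision n} {x y : Fin n} {pos pos' : Fin n → ℕ}
    (h : ∀ a ∈ closedArc x y, ∀ b ∈ closedArc x y, pos a < pos b ↔ pos' a < pos' b) :
    σ.Oriented x y pos ↔ σ.Oriented x y pos' := by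
  unfold Oriented
  refine forall₂_congr fun Q _ => forall₂_congr fun a _ => forall₂_congr fun m _ =>
    forall₂_congr fun b _ => forall_congr' fun ha => forall_congr' fun hm => forall_congr' fun hb =>
    forall_congr' fun _ => ?_
  unfold CycOrd
  rw [h a ha b hb, h b hb m hm, h m hm a ha]

/-- For `Q`, cyclic orientations on the two halves glue along the triangle `x p y`. Any other
polygon either lies in one half or has too few vertices in `[x, y]` to impose a condition. -/
theorem oriented_split {Q : Finset (Fin n)} (hQ : Q ∈ σ.polygons) {x p y : Fin n}
    (hx : x ∈ Q) (hp : p ∈ Q) (hy : y ∈ Q) (h : p ∈ openArc x y) {pos : Fin n → ℕ}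
    (hpos : ∀ a ∈ closedArc x y, ∀ b ∈ closedArc x y, pos a = pos b → a = b) :
    σ.Oriented x y pos ↔ (CycOrd (pos x) (pos y) (pos p) ↔ Q ∈ σ.black) ∧
      σ.Oriented x p pos ∧ σ.Oriented p y pos := by
  have hc := mem_openArc.mp h
  have hs1 : closedArc x p ⊆ closedArc x y := by
    intro z hz
    simp only [mem_closedArc] at *
    unfold CycOrd at *
    omega
  have hs2 : closedArc p y ⊆ closedArc x y := by
    intro z hz
    simp only [mem_closedArc] at *
    unfold CycOrd at *
    omega
  have hxm : x ∈ closedArc x y := by simp only [mem_closedArc]; omega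
  have hym : y ∈ closedArc x y := by simp only [mem_closedArc]; omega
  have hpm : p ∈ closedArc x y := by simp only [mem_closedArc]; unfold CycOrd at *; omega
  constructor
  · intro hO
    exact ⟨hO Q hQ x hx p hp y hy hxm hpm hym hc, hO.mono hs1, hO.mono hs2⟩
  · rintro ⟨hO, h1, h2⟩ R hR a ha m hm b hb ha' hm' hb' hcyc
    have hne : ∀ a ∈ closedArc x y, ∀ b ∈ closedArc x y, a.val ≠ b.val → pos a ≠ pos b :=
      fun a ha b hb hab h => hab (congrArg Fin.val (hpos a ha b hb h))
    by_cases hRQ : Q = R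
    · subst hRQ
      by_cases hB : Q ∈ σ.black
      · simp only [hB, iff_true] at hO ⊢
        refine glue_orientation (O := fun a m b => CycOrd (pos a) (pos b) (pos m)) (S := Q)
          (fun a b c h => h.rotate.rotate) ?_ hx hp hy h hO ?_ ?_ ha hm hb ha' hm' hb' hcyc
        · intro a b c d h h'
          have := h'.trans h
          exact ⟨this.1, this.2.rotate.rotate⟩
        · exact fun a ha m hm b hb h1' h2' h3' h4' =>
            (h1 Q hQ a ha m hm b hb h1' h2' h3' h4').mpr hB
        · exact fun a ha m hm b hb h1' h2' h3' h4' =>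
            (h2 Q hQ a ha m hm b hb h1' h2' h3' h4').mpr hB
      -- For distinct positions, not counterclockwise means clockwise, so the white case is again a
      -- cyclic orientation to which gluing applies.
      · have conv : ∀ a ∈ closedArc x y, ∀ m ∈ closedArc x y, ∀ b ∈ closedArc x y,
            CycOrd a.val m.val b.val →
            ((CycOrd (pos a) (pos b) (pos m) ↔ Q ∈ σ.black) ↔
              CycOrd (pos a) (pos m) (pos b)) := by
          intro a ha m hm b hb h
          have hn := h.ne
          rw [← CycOrd.not_iff (hne a ha b hb hn.2.2) (hne b hb m hm hn.2.1.symm)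
            (hne a ha m hm hn.1)]
          simp [hB]
        rw [conv a ha' m hm' b hb' hcyc]
        rw [conv x hxm p hpm y hym hc] at hO
        refine glue_orientation (O := fun a m b => CycOrd (pos a) (pos m) (pos b)) (S := Q)
          (fun a b c h => h.rotate) (fun a b c d h h' => h.trans h') hx hp hy h hO ?_ ?_
          ha hm hb ha' hm' hb' hcyc
        · exact fun a ha m hm b hb h1' h2' h3' h4' =>
            (conv a (hs1 h1') m (hs1 h2') b (hs1 h3') h4').mp
              (h1 Q hQ a ha m hm b hb h1' h2' h3' h4')
        · exact fun a ha m hm b hb h1' h2' h3' h4' =>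
            (conv a (hs2 h1') m (hs2 h2') b (hs2 h3') h4').mp
              (h2 Q hQ a ha m hm b hb h1' h2' h3' h4')
    · rcases σ.polygon_location hQ hR hRQ hx hp hy h with hl | hl | hl
      · exact h1 R hR a ha m hm b hb (hl ha) (hl hm) (hl hb) hcyc
      · exact h2 R hR a ha m hm b hb (hl ha) (hl hm) (hl hb) hcyc
      · exfalso
        have := hl ha
        have := hl hm
        have := hl hb
        simp only [mem_closedArc] at *
        unfold CycOrd at *
        omega

end BicoloredSubdivision

end

/-! ### Sums over the words on one side of an arc -/

section SideSum

variable {n : ℕ} [NeZero n] {F : Type*} [Field F]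

/-- The position of the letters in the word `s v t`. -/
def wordPos (s t : Fin n) (v : List (Fin n)) (a : Fin n) : ℕ := (s :: (v ++ [t])).idxOf a

omit [NeZero n] in
theorem wordPos_filter_lt {s t : Fin n} {A : Finset (Fin n)} {v : List (Fin n)} (hs : s ∉ v)
    (ht : t ∉ v) {a b : Fin n} (ha : a ∈ A ∨ a = s ∨ a = t) (hb : b ∈ A ∨ b = s ∨ b = t) :
    wordPos s t (v.filter (· ∈ A)) a < wordPos s t (v.filter (· ∈ A)) b ↔
      wordPos s t v a < wordPos s t v b := by
  have h : s :: (v.filter (· ∈ A) ++ [t]) =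
      (s :: (v ++ [t])).filter fun z => decide (z ∈ A ∨ z = s ∨ z = t) := by
    rw [List.filter_cons_of_pos (by simp), List.filter_append, List.filter_cons_of_pos (by simp),
      List.filter_nil]
    congr 2
    refine List.filter_congr fun z hz => ?_
    have h1 : z ≠ s := by rintro rfl; exact hs hz
    have h2 : z ≠ t := by rintro rfl; exact ht hz
    simp [h1, h2]
  unfold wordPos
  rw [h]
  exact idxOf_filter_lt (by simpa using ha) (by simpa using hb) _

/-- The properties of the Plücker coordinates on the letters of the arc `[x, y]`, the letters `x`
and `y` being identified; words begin with `s` and end with `t`, where `{s, t} = {x, y}`. -/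
structure ArcPlucker (x y s t : Fin n) (p : Fin n → Fin n → F) : Prop where
  anti : ∀ a b, p a b = -p b a
  plucker : ∀ a b c d, p a b * p c d - p a c * p b d + p a d * p b c = 0
  ends : s = x ∧ t = y ∨ s = y ∧ t = x
  ne : x ≠ y
  self_start : p s s = 0
  end_start : p t s = 0
  ne_zero : ∀ b ∈ openArc x y, ∀ a ∈ closedArc x y, a ≠ b → p a b ≠ 0

variable {x₀ y₀ s t : Fin n} {p : Fin n → Fin n → F}

namespace ArcPlucker

variable (H : ArcPlucker x₀ y₀ s t p)
include H

theorem start_notMem : s ∉ openArc x₀ y₀ := by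
  rw [mem_openArc]; rcases H.ends with ⟨rfl, rfl⟩ | ⟨rfl, rfl⟩ <;> unfold CycOrd <;> omega

theorem end_notMem : t ∉ openArc x₀ y₀ := by
  rw [mem_openArc]; rcases H.ends with ⟨rfl, rfl⟩ | ⟨rfl, rfl⟩ <;> unfold CycOrd <;> omega

theorem start_ne_end : s ≠ t := by
  have := H.ne
  rcases H.ends with ⟨rfl, rfl⟩ | ⟨rfl, rfl⟩
  · exact this
  · exact this.symm

theorem mem_closedArc_iff (a : Fin n) :
    a ∈ closedArc x₀ y₀ ↔ a ∈ openArc x₀ y₀ ∨ a = s ∨ a = t := by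
  have h := Fin.val_ne_of_ne H.ne
  rcases H.ends with ⟨rfl, rfl⟩ | ⟨rfl, rfl⟩ <;>
    (rw [mem_openArc, mem_closedArc, Fin.ext_iff, Fin.ext_iff]; unfold CycOrd; omega)

theorem nodup_ext {A : Finset (Fin n)} (hA : A ⊆ openArc x₀ y₀) {v : List (Fin n)}
    (hv : v ∈ words A) : (s :: (v ++ [t])).Nodup := by
  have h1 : s ∉ v := fun h => H.start_notMem (hA ((mem_of_mem_words hv).mp h))
  have h2 : t ∉ v := fun h => H.end_notMem (hA ((mem_of_mem_words hv).mp h))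
  rw [List.nodup_cons, List.mem_append, List.mem_singleton,
    ← List.concat_eq_append, List.nodup_concat]
  exact ⟨fun h => h.elim h1 H.start_ne_end, h2, (mem_words.mp hv).1⟩

omit H [NeZero n] in
theorem mem_ext_iff {A : Finset (Fin n)} {v : List (Fin n)}
    (hv : v ∈ words A) {a : Fin n} : a ∈ s :: (v ++ [t]) ↔ a ∈ A ∨ a = s ∨ a = t := by
  simp only [List.mem_cons, List.mem_append, List.not_mem_nil, or_false, mem_of_mem_words hv]
  tauto

theorem wordPos_filter_lt {A B : Finset (Fin n)} (hB : B ⊆ openArc x₀ y₀) {v : List (Fin n)}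
    (hv : v ∈ words B) {a b : Fin n} (ha : a ∈ A ∨ a = s ∨ a = t) (hb : b ∈ A ∨ b = s ∨ b = t) :
    wordPos s t (v.filter (· ∈ A)) a < wordPos s t (v.filter (· ∈ A)) b ↔
      wordPos s t v a < wordPos s t v b :=
  ParkeTaylor.wordPos_filter_lt
    (fun h => H.start_notMem (hB ((mem_of_mem_words hv).mp h)))
    (fun h => H.end_notMem (hB ((mem_of_mem_words hv).mp h))) ha hb

omit H [NeZero n] in
theorem wordPos_inj {v : List (Fin n)} {A : Finset (Fin n)}
    (hv : v ∈ words A) {a b : Fin n} (ha : a ∈ A ∨ a = s ∨ a = t)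
    (h : wordPos s t v a = wordPos s t v b) : a = b :=
  (List.idxOf_inj ((mem_ext_iff hv).mpr ha)).mp h

/-- The factor `p s t` vanishes as `s` and `t` are identified. It does not occur, since a nonempty
word keeps `s` and `t` apart. -/
theorem chainProd_ne_zero {A : Finset (Fin n)} (hA : A ⊆ openArc x₀ y₀) (hne : A.Nonempty)
    {v : List (Fin n)} (hv : v ∈ words A) : chainProd p (s :: (v ++ [t])) ≠ 0 := by
  rw [chainProd_ne_zero_iff, List.isChain_iff_getElem]
  intro k hk
  have hnd := H.nodup_ext hA hv
  have hvlen : v ≠ [] := by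
    rintro rfl
    obtain ⟨a, ha⟩ := hne
    simpa using (mem_of_mem_words hv).mpr ha
  have hv0 : 0 < v.length := List.length_pos_iff.mpr hvlen
  have hlen : (s :: (v ++ [t])).length = v.length + 2 := by simp
  have hneq : (s :: (v ++ [t]))[k] ≠ (s :: (v ++ [t]))[k + 1] := by
    intro h
    have := (List.Nodup.getElem_inj_iff hnd).mp h
    omega
  have hcl : ∀ (m : ℕ) (hm : m < (s :: (v ++ [t])).length),
      (s :: (v ++ [t]))[m] ∈ closedArc x₀ y₀ := by
    intro m hm
    rw [H.mem_closedArc_iff]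
    exact ((mem_ext_iff hv).mp (List.getElem_mem hm)).imp_left fun h => hA h
  have hin : ∀ (m : ℕ) (_ : m < v.length) (hm' : m + 1 < (s :: (v ++ [t])).length),
      (s :: (v ++ [t]))[m + 1] ∈ openArc x₀ y₀ := by
    intro m hm hm'
    rw [List.getElem_cons_succ, List.getElem_append_left hm]
    exact hA ((mem_of_mem_words hv).mp (List.getElem_mem hm))
  by_cases hk' : k < v.length
  · exact H.ne_zero _ (hin k hk' hk) _ (hcl k (by omega)) hneq
  · obtain ⟨m, rfl⟩ : ∃ m, k = m + 1 := ⟨k - 1, by omega⟩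
    rw [H.anti]
    exact neg_ne_zero.mpr (H.ne_zero _ (hin m (by omega) (by omega)) _ (hcl _ hk) hneq.symm)

end ArcPlucker

end SideSum

namespace ArcPlucker

variable {n : ℕ} [NeZero n] {F : Type*} [Field F]
variable {x₀ y₀ s t : Fin n} {p : Fin n → Fin n → F}

theorem cycOrd_filter (H : ArcPlucker x₀ y₀ s t p) {A B : Finset (Fin n)}
    (hB : B ⊆ openArc x₀ y₀) {v : List (Fin n)} (hv : v ∈ words B) {a b c : Fin n}
    (ha : a ∈ A ∨ a = s ∨ a = t) (hb : b ∈ A ∨ b = s ∨ b = t) (hc : c ∈ A ∨ c = s ∨ c = t) :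
    CycOrd (wordPos s t (v.filter (· ∈ A)) a) (wordPos s t (v.filter (· ∈ A)) b)
        (wordPos s t (v.filter (· ∈ A)) c) ↔
      CycOrd (wordPos s t v a) (wordPos s t v b) (wordPos s t v c) := by
  unfold CycOrd
  rw [H.wordPos_filter_lt hB hv ha hb, H.wordPos_filter_lt hB hv hb hc,
    H.wordPos_filter_lt hB hv hc ha]

theorem oriented_filter (H : ArcPlucker x₀ y₀ s t p) (σ : BicoloredSubdivision n)
    {A B : Finset (Fin n)} (hB : B ⊆ openArc x₀ y₀) {v : List (Fin n)} (hv : v ∈ words B)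
    {x y : Fin n} (h : ∀ a ∈ closedArc x y, a ∈ A ∨ a = s ∨ a = t) :
    σ.Oriented x y (wordPos s t (v.filter (· ∈ A))) ↔ σ.Oriented x y (wordPos s t v) :=
  BicoloredSubdivision.Oriented.congr fun a ha b hb =>
    H.wordPos_filter_lt hB hv (h a ha) (h b hb)

theorem mem_closedArc_cases {x y a : Fin n} (h : a ∈ closedArc x y) :
    a ∈ openArc x y ∨ a = x ∨ a = y := by
  rw [mem_closedArc] at h
  rw [mem_openArc, Fin.ext_iff, Fin.ext_iff, CycOrd]
  omega

theorem openArc_split {x q y : Fin n} (h : q ∈ openArc x y) :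
    openArc x y = insert q (openArc x q ∪ openArc q y) ∧
      Disjoint (openArc x q) (openArc q y) ∧ q ∉ openArc x q ∧ q ∉ openArc q y := by
  rw [mem_openArc] at h
  refine ⟨?_, ?_, ?_, ?_⟩
  · ext z
    simp only [Finset.mem_insert, Finset.mem_union, mem_openArc, Fin.ext_iff]
    unfold CycOrd at *
    omega
  · rw [Finset.disjoint_left]
    intro z
    simp only [mem_openArc]
    unfold CycOrd at *
    omega
  · rw [mem_openArc]; unfold CycOrd at *; omega
  · rw [mem_openArc]; unfold CycOrd at *; omega

-- Induction on the length of the arc. On a boundary arc nothing is inserted and the factor is `p x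
-- y / p x y = 1`. Otherwise a polygon has vertices `x, q, y`: inserting `q` with the orientation of
-- its colour gives `± p x y / (p x q * p q y)`, and the arcs `x → q` and `q → y` give their factors
-- by induction, in which `p x q` and `p q y` cancel. Nonemptiness of `A` and an end of the arc
-- inside `openArc x₀ y₀` keep the denominators nonzero.
set_option maxHeartbeats 800000 in
open Classical in
theorem sum_oriented (H : ArcPlucker x₀ y₀ s t p) (σ : BicoloredSubdivision n) (m : ℕ) :
    ∀ x y : Fin n, (y - x).val = m → σ.IsCompatible x y → openArc x y ⊆ openArc x₀ y₀ →
      (x ∈ openArc x₀ y₀ ∨ y ∈ openArc x₀ y₀) →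
      ∀ A : Finset (Fin n), A ⊆ openArc x₀ y₀ → A.Nonempty → Disjoint A (openArc x y) →
      (x ∈ A ∨ x = s ∨ x = t) → (y ∈ A ∨ y = s ∨ y = t) → ∀ u ∈ words A,
      ∑ v ∈ words (A ∪ openArc x y) with
          v.filter (· ∈ A) = u ∧ σ.Oriented x y (wordPos s t v),
        (chainProd p (s :: (v ++ [t])))⁻¹ =
      (-1) ^ σ.area x y * (p x y / ∏ c ∈ halfOpenArc x y, p c (c + 1)) *
        (chainProd p (s :: (u ++ [t])))⁻¹ := by
  induction m using Nat.strong_induction_on with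
  | _ m ih =>
  intro x y hm hcomp hsub hxy A hA hAne hdisj hx hy u hu
  have hcl : ∀ a, (a ∈ A ∨ a = s ∨ a = t) → a ∈ closedArc x₀ y₀ := fun a ha =>
    (H.mem_closedArc_iff a).mpr (ha.imp_left fun h => hA h)
  have hne0 : ∀ a b, a ≠ b → a ∈ closedArc x₀ y₀ → b ∈ closedArc x₀ y₀ →
      (a ∈ openArc x₀ y₀ ∨ b ∈ openArc x₀ y₀) → p a b ≠ 0 := by
    rintro a b hab ha hb (h | h)
    · rw [H.anti]; exact neg_ne_zero.mpr (H.ne_zero a h b hb hab.symm)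
    · exact H.ne_zero b h a ha hab
  rcases σ.exists_split hcomp with rfl | ⟨Q, hQ, q, hxQ, hqQ, hyQ, hq⟩
  · rw [openArc_succ, Finset.union_empty, halfOpenArc_succ hcomp.1, Finset.prod_singleton,
      σ.area_succ, div_self (hne0 _ _ hcomp.1 (hcl _ hx) (hcl _ hy) hxy)]
    have : (words A).filter (fun v => v.filter (· ∈ A) = u ∧
        σ.Oriented x (x + 1) (wordPos s t v)) = {u} := by
      ext v
      simp only [Finset.mem_filter, σ.oriented_succ, and_true, Finset.mem_singleton]
      have hself : ∀ v ∈ words A, v.filter (· ∈ A) = v := fun v hv =>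
        List.filter_eq_self.mpr fun z hz => by simpa using (mem_of_mem_words hv).mp hz
      constructor
      · rintro ⟨hv, h⟩; rw [← h, hself v hv]
      · rintro rfl; exact ⟨hu, hself _ hu⟩
    rw [this, Finset.sum_singleton]
    simp
  · obtain ⟨hlt1, hlt2⟩ := arc_length_lt hq
    obtain ⟨hsplit, hd, hq1, hq2⟩ := openArc_split hq
    have hqo : q ∈ openArc x₀ y₀ := hsub hq
    have hsub1 : openArc x q ⊆ openArc x y := by
      rw [hsplit]; exact Finset.subset_union_left.trans (Finset.subset_insert _ _)
    have hsub2 : openArc q y ⊆ openArc x y := by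
      rw [hsplit]; exact Finset.subset_union_right.trans (Finset.subset_insert _ _)
    have hqA : q ∉ A := fun h => Finset.disjoint_left.mp hdisj h hq
    have hcyc := mem_openArc.mp hq
    have hxq : x ≠ q := fun h => hcyc.ne.1 (congrArg Fin.val h)
    have hqy : q ≠ y := fun h => hcyc.ne.2.1 (congrArg Fin.val h)
    -- Three batches of letters: first `q`, then those between `x` and `q`, then those between `q`
    -- and `y`.
    set B₁ := insert q A with hB₁
    set B₂ := B₁ ∪ openArc x q with hB₂
    set C := A ∪ openArc x y with hC
    have hC2 : B₂ ∪ openArc q y = C := by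
      rw [hB₂, hB₁, hC, hsplit, Finset.insert_union, Finset.insert_union, Finset.union_insert,
        Finset.union_assoc]
    have hB₁o : B₁ ⊆ openArc x₀ y₀ := Finset.insert_subset hqo hA
    have hB₂o : B₂ ⊆ openArc x₀ y₀ := Finset.union_subset hB₁o (hsub1.trans hsub)
    have hCo : C ⊆ openArc x₀ y₀ := Finset.union_subset hA hsub
    have hAB₁ : A ⊆ B₁ := Finset.subset_insert _ _
    have hB₁₂ : B₁ ⊆ B₂ := Finset.subset_union_left
    have hB₂C : B₂ ⊆ C := hC2 ▸ Finset.subset_union_left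
    have hxB : ∀ {B : Finset (Fin n)}, A ⊆ B → (x ∈ B ∨ x = s ∨ x = t) :=
      fun h => hx.imp_left fun h' => h h'
    have hyB : ∀ {B : Finset (Fin n)}, A ⊆ B → (y ∈ B ∨ y = s ∨ y = t) :=
      fun h => hy.imp_left fun h' => h h'
    have hqB₁ : q ∈ B₁ := Finset.mem_insert_self _ _
    have hcl1 : ∀ a ∈ closedArc x q, a ∈ B₂ ∨ a = s ∨ a = t := by
      intro a ha
      rcases mem_closedArc_cases ha with h | rfl | rfl
      · exact Or.inl (Finset.mem_union_right _ h)
      · exact hxB (hAB₁.trans hB₁₂)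
      · exact Or.inl (hB₁₂ hqB₁)
    have hclC : ∀ a ∈ closedArc x y, a ∈ C ∨ a = s ∨ a = t := by
      intro a ha
      rcases mem_closedArc_cases ha with h | rfl | rfl
      · exact Or.inl (Finset.mem_union_right _ h)
      · exact hxB Finset.subset_union_left
      · exact hyB Finset.subset_union_left
    have step3 : ∀ v₂ ∈ words B₂, ∑ v ∈ words C with
          v.filter (· ∈ B₂) = v₂ ∧ σ.Oriented q y (wordPos s t v),
        (chainProd p (s :: (v ++ [t])))⁻¹ =
        (-1) ^ σ.area q y * (p q y / ∏ c ∈ halfOpenArc q y, p c (c + 1)) *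
          (chainProd p (s :: (v₂ ++ [t])))⁻¹ := by
      intro v₂ hv₂
      rw [← hC2]
      refine ih _ (hm ▸ hlt2) q y rfl ⟨hqy, Q, hQ, hqQ, hyQ⟩ (hsub2.trans hsub) (Or.inl hqo) B₂
        hB₂o ⟨q, hB₁₂ hqB₁⟩ ?_ (Or.inl (hB₁₂ hqB₁)) (hyB (hAB₁.trans hB₁₂)) v₂ hv₂
      rw [hB₂, hB₁, Finset.disjoint_union_left, Finset.disjoint_insert_left]
      exact ⟨⟨hq2, Finset.disjoint_of_subset_right hsub2 hdisj⟩, hd⟩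
    have step2 : ∀ v₁ ∈ words B₁, ∑ v ∈ words B₂ with
          v.filter (· ∈ B₁) = v₁ ∧ σ.Oriented x q (wordPos s t v),
        (chainProd p (s :: (v ++ [t])))⁻¹ =
        (-1) ^ σ.area x q * (p x q / ∏ c ∈ halfOpenArc x q, p c (c + 1)) *
          (chainProd p (s :: (v₁ ++ [t])))⁻¹ := by
      intro v₁ hv₁
      refine ih _ (hm ▸ hlt1) x q rfl ⟨hxq, Q, hQ, hxQ, hqQ⟩ (hsub1.trans hsub) (Or.inr hqo) B₁
        hB₁o ⟨q, hqB₁⟩ ?_ (hxB hAB₁) (Or.inl hqB₁) v₁ hv₁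
      rw [hB₁, Finset.disjoint_insert_left]
      exact ⟨hq1, Finset.disjoint_of_subset_right hsub1 hdisj⟩
    have step1 : ∑ v ∈ words B₁ with v.filter (· ∈ A) = u ∧
          (CycOrd (wordPos s t v x) (wordPos s t v y) (wordPos s t v q) ↔ Q ∈ σ.black),
        (chainProd p (s :: (v ++ [t])))⁻¹ =
        (if Q ∈ σ.black then -1 else 1) * (p x y / (p x q * p q y)) *
          (chainProd p (s :: (u ++ [t])))⁻¹ := by
      rw [hB₁, sum_words_insert hqA hu]
      have hqs : q ≠ s := by rintro rfl; exact H.start_notMem hqo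
      have hqt : q ≠ t := by rintro rfl; exact H.end_notMem hqo
      have hqu : q ∉ s :: (u ++ [t]) := by
        rw [mem_ext_iff hu]
        exact fun h => h.elim hqA fun h => h.elim hqs hqt
      have hqne : ∀ a ∈ s :: (u ++ [t]), p a q ≠ 0 := fun a ha =>
        H.ne_zero q hqo a (hcl a ((mem_ext_iff hu).mp ha)) (by rintro rfl; exact hqu ha)
      refine Eq.trans (Finset.sum_congr ?_ fun _ _ => rfl)
        (sum_insertAt_inv_chainProd p H.anti H.plucker H.self_start H.end_start
          ((mem_ext_iff hu).mpr hx) ((mem_ext_iff hu).mpr hy) hcomp.1 hqu hqne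
          (H.chainProd_ne_zero hA hAne hu) (Q ∈ σ.black))
      ext k
      simp only [Finset.mem_filter]
      rfl
    -- Each condition produced by `oriented_split` is read on the smallest stage that contains all
    -- its letters.
    have hfil : (words C).filter (fun v => v.filter (· ∈ A) = u ∧
          σ.Oriented x y (wordPos s t v)) =
        (words C).filter (fun v => v.filter (· ∈ A) = u ∧
          (CycOrd (wordPos s t (v.filter (· ∈ B₁)) x) (wordPos s t (v.filter (· ∈ B₁)) y)
            (wordPos s t (v.filter (· ∈ B₁)) q) ↔ Q ∈ σ.black) ∧
          (σ.Oriented x q (wordPos s t (v.filter (· ∈ B₂))) ∧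
            σ.Oriented q y (wordPos s t v))) := by
      refine Finset.filter_congr fun v hv => and_congr_right fun _ => ?_
      rw [σ.oriented_split hQ hxQ hqQ hyQ hq
        (fun a ha b hb h => wordPos_inj hv (hclC a ha) h),
        H.cycOrd_filter hCo hv (hxB hAB₁) (hyB hAB₁) (Or.inl hqB₁),
        H.oriented_filter σ hCo hv hcl1]
    have hin : ∀ v₁ ∈ (words B₁).filter (fun v => v.filter (· ∈ A) = u ∧
          (CycOrd (wordPos s t v x) (wordPos s t v y) (wordPos s t v q) ↔ Q ∈ σ.black)),
        ∑ v ∈ words C with v.filter (· ∈ B₁) = v₁ ∧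
          (σ.Oriented x q (wordPos s t (v.filter (· ∈ B₂))) ∧ σ.Oriented q y (wordPos s t v)),
        (chainProd p (s :: (v ++ [t])))⁻¹ =
        (-1) ^ σ.area q y * (p q y / ∏ c ∈ halfOpenArc q y, p c (c + 1)) *
        ((-1) ^ σ.area x q * (p x q / ∏ c ∈ halfOpenArc x q, p c (c + 1)) *
          (chainProd p (s :: (v₁ ++ [t])))⁻¹) := by
      intro v₁ hv₁
      rw [sum_words_fiber hB₁₂ hB₂C v₁ (fun v => σ.Oriented x q (wordPos s t v))
        (fun v => σ.Oriented q y (wordPos s t v)),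
        ← step2 v₁ (Finset.mem_of_mem_filter _ hv₁), Finset.mul_sum]
      exact Finset.sum_congr rfl fun v₂ hv₂ => step3 v₂ (Finset.mem_of_mem_filter _ hv₂)
    rw [hfil, sum_words_fiber hAB₁ (hB₁₂.trans hB₂C) u
      (fun v => (CycOrd (wordPos s t v x) (wordPos s t v y) (wordPos s t v q) ↔ Q ∈ σ.black))
      (fun v => σ.Oriented x q (wordPos s t (v.filter (· ∈ B₂))) ∧
        σ.Oriented q y (wordPos s t v)),
      Finset.sum_congr rfl hin, ← Finset.mul_sum, ← Finset.mul_sum, step1,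
      σ.area_split hQ hxQ hqQ hyQ hq, (halfOpenArc_split hq).2,
      Finset.prod_union (halfOpenArc_split hq).1]
    have hqc : q ∈ closedArc x₀ y₀ := (H.mem_closedArc_iff q).mpr (Or.inl hqo)
    have e1 : p x q ≠ 0 := hne0 x q hxq (hcl x hx) hqc (Or.inr hqo)
    have e2 : p q y ≠ 0 := hne0 q y hqy hqc (hcl y hy) (Or.inl hqo)
    have e3 : ((-1 : F) ^ (if Q ∈ σ.black then 1 else 0)) = if Q ∈ σ.black then -1 else 1 := by
      split_ifs <;> simp
    rw [pow_add, pow_add, e3]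
    simp only [div_eq_mul_inv, mul_inv]
    field_simp

open Classical in
/-- The sum of the Parke–Taylor functions of all words on one side of the arc `x₀ → y₀` that are
compatible with `σ`. -/
theorem sum_oriented_side (H : ArcPlucker x₀ y₀ s t p) (σ : BicoloredSubdivision n)
    {Q : Finset (Fin n)} (hQ : Q ∈ σ.polygons) (hE : IsEdge Q y₀ x₀)
    (hcol : Q ∈ σ.black ↔ s = y₀) :
    ∑ v ∈ words (openArc x₀ y₀) with σ.Oriented x₀ y₀ (wordPos s t v),
        (chainProd p (s :: (v ++ [t])))⁻¹ =
      (-1) ^ (σ.area x₀ y₀ + if Q ∈ σ.black then 1 else 0) *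
        (∏ c ∈ halfOpenArc x₀ y₀, p c (c + 1))⁻¹ := by
  have hxQ := hE.2.1
  have hyQ := hE.1
  -- A third vertex of `Q` lies inside the arc, because `y₀ → x₀` is an edge of `Q`.
  obtain ⟨q, hqQ, hq⟩ : ∃ q ∈ Q, q ∈ openArc x₀ y₀ := by
    have h3 := σ.three_le_card Q hQ
    obtain ⟨q, hq, hq'⟩ := Finset.exists_mem_notMem_of_card_lt_card
      (s := {x₀, y₀}) (t := Q) (lt_of_le_of_lt (Finset.card_le_two) (by omega))
    refine ⟨q, hq, ?_⟩
    simp only [Finset.mem_insert, Finset.mem_singleton, not_or, Fin.ext_iff] at hq'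
    have h1 := BicoloredSubdivision.IsEdge.not_mem hE hq
    have := Fin.val_ne_of_ne H.ne
    rw [mem_openArc]
    unfold CycOrd at *
    omega
  obtain ⟨hsplit, hd, hq1, hq2⟩ := openArc_split hq
  have hcyc := mem_openArc.mp hq
  have hxq : x₀ ≠ q := fun h => hcyc.ne.1 (congrArg Fin.val h)
  have hqy : q ≠ y₀ := fun h => hcyc.ne.2.1 (congrArg Fin.val h)
  have hsub1 : openArc x₀ q ⊆ openArc x₀ y₀ := by
    rw [hsplit]; exact Finset.subset_union_left.trans (Finset.subset_insert _ _)
  have hsub2 : openArc q y₀ ⊆ openArc x₀ y₀ := by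
    rw [hsplit]; exact Finset.subset_union_right.trans (Finset.subset_insert _ _)
  -- The construction starts from the word `s q t`: the empty word would give the vanishing product
  -- `p s t`.
  set B : Finset (Fin n) := {q} ∪ openArc x₀ q with hB
  have hqB : q ∈ B := by simp [hB]
  have hCB : B ∪ openArc q y₀ = openArc x₀ y₀ := by
    rw [hsplit, hB, ← Finset.insert_eq, Finset.insert_union]
  have hBo : B ⊆ openArc x₀ y₀ := hCB ▸ Finset.subset_union_left
  have hxst : x₀ = s ∨ x₀ = t := by rcases H.ends with h | h <;> simp [h]
  have hyst : y₀ = s ∨ y₀ = t := by rcases H.ends with h | h <;> simp [h]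
  have hcl1 : ∀ a ∈ closedArc x₀ q, a ∈ B ∨ a = s ∨ a = t := by
    intro a ha
    rcases mem_closedArc_cases ha with h | rfl | rfl
    · exact Or.inl (Finset.mem_union_right _ h)
    · exact Or.inr hxst
    · exact Or.inl hqB
  have hself : ∀ v ∈ words ({q} : Finset (Fin n)), v = [q] := by
    intro v hv
    have h := mem_words.mp hv
    have hlen := List.toFinset_card_of_nodup h.1
    rw [h.2, Finset.card_singleton] at hlen
    obtain ⟨a, rfl⟩ := List.length_eq_one_iff.mp hlen.symm
    simpa using h.2
  have hmem : [q] ∈ words ({q} : Finset (Fin n)) := mem_words.mpr (by simp)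
  have step3 : ∀ v₂ ∈ words B, ∑ v ∈ words (openArc x₀ y₀) with
        v.filter (· ∈ B) = v₂ ∧ σ.Oriented q y₀ (wordPos s t v),
      (chainProd p (s :: (v ++ [t])))⁻¹ =
      (-1) ^ σ.area q y₀ * (p q y₀ / ∏ c ∈ halfOpenArc q y₀, p c (c + 1)) *
        (chainProd p (s :: (v₂ ++ [t])))⁻¹ := by
    intro v₂ hv₂
    rw [← hCB]
    refine H.sum_oriented σ _ q y₀ rfl ⟨hqy, Q, hQ, hqQ, hyQ⟩ hsub2 (Or.inl hq) B
      hBo ⟨q, hqB⟩ ?_ (Or.inl hqB) (Or.inr hyst) v₂ hv₂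
    rw [hB, Finset.disjoint_union_left, Finset.disjoint_singleton_left]
    exact ⟨hq2, hd⟩
  have step2 : ∑ v ∈ words B with
        v.filter (· ∈ ({q} : Finset (Fin n))) = [q] ∧ σ.Oriented x₀ q (wordPos s t v),
      (chainProd p (s :: (v ++ [t])))⁻¹ =
      (-1) ^ σ.area x₀ q * (p x₀ q / ∏ c ∈ halfOpenArc x₀ q, p c (c + 1)) *
        (chainProd p (s :: ([q] ++ [t])))⁻¹ :=
    H.sum_oriented σ _ x₀ q rfl ⟨hxq, Q, hQ, hxQ, hqQ⟩ hsub1 (Or.inr hq) {q}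
      (by simpa using hq) ⟨q, by simp⟩ (by simpa using hq1) (Or.inr hxst) (by simp) [q] hmem
  have hfil : (words (openArc x₀ y₀)).filter (fun v => σ.Oriented x₀ y₀ (wordPos s t v)) =
      (words (openArc x₀ y₀)).filter (fun v => v.filter (· ∈ ({q} : Finset (Fin n))) = [q] ∧
        (σ.Oriented x₀ q (wordPos s t (v.filter (· ∈ B))) ∧
          σ.Oriented q y₀ (wordPos s t v))) := by
    refine Finset.filter_congr fun v hv => ?_
    have hqA := hself _ (filter_mem_words (A := {q}) (by simpa using hq) hv)
    -- The letters `s, q, t` always occur in this order, and `hcol` makes it the orientation that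
    -- the colour of `Q` demands.
    have hor : CycOrd (wordPos s t v x₀) (wordPos s t v y₀) (wordPos s t v q) ↔
        Q ∈ σ.black := by
      have hqs : q ≠ s := by rintro rfl; exact H.start_notMem hq
      have hqt : q ≠ t := by rintro rfl; exact H.end_notMem hq
      rw [← H.cycOrd_filter (A := {q}) subset_rfl hv (Or.inr hxst) (Or.inr hyst) (by simp), hqA]
      have p1 : wordPos s t [q] s = 0 := by simp [wordPos]
      have p2 : wordPos s t [q] q = 1 := by
        simp [wordPos, List.idxOf_cons_ne _ hqs.symm]
      have p3 : wordPos s t [q] t = 2 := by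
        simp [wordPos, List.idxOf_cons_ne _ H.start_ne_end, List.idxOf_cons_ne _ hqt]
      rw [hcol]
      rcases H.ends with ⟨h1, h2⟩ | ⟨h1, h2⟩
      · rw [← h1, ← h2, p1, p2, p3]
        simp [CycOrd, H.start_ne_end]
      · rw [← h1, ← h2, p1, p2, p3]
        simp [CycOrd]
    rw [hqA, H.oriented_filter σ subset_rfl hv hcl1, σ.oriented_split hQ hxQ hqQ hyQ hq
        (fun a ha b hb h => wordPos_inj hv ((H.mem_closedArc_iff a).mp ha) h)]
    simp [hor]
  have e1 : p x₀ q ≠ 0 := H.ne_zero q hq x₀ ((H.mem_closedArc_iff x₀).mpr (Or.inr hxst)) hxq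
  have e2 : p q y₀ ≠ 0 := by
    rw [H.anti]
    exact neg_ne_zero.mpr
      (H.ne_zero q hq y₀ ((H.mem_closedArc_iff y₀).mpr (Or.inr hyst)) hqy.symm)
  rw [hfil, sum_words_fiber (by simpa using hqB) hBo [q]
    (fun v => σ.Oriented x₀ q (wordPos s t v)) (fun v => σ.Oriented q y₀ (wordPos s t v)),
    Finset.sum_congr rfl fun v₂ hv₂ => step3 v₂ (Finset.mem_of_mem_filter _ hv₂),
    ← Finset.mul_sum, step2, σ.area_split hQ hxQ hqQ hyQ hq, (halfOpenArc_split hq).2,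
    Finset.prod_union (halfOpenArc_split hq).1]
  have hchain : chainProd p (s :: ([q] ++ [t])) = p s q * p q t := by
    simp [chainProd]
  have hval : chainProd p (s :: ([q] ++ [t])) = p x₀ q * p q y₀ := by
    rw [hchain]
    rcases H.ends with ⟨h1, h2⟩ | ⟨h1, h2⟩
    · rw [h1, h2]
    · rw [h1, h2, H.anti y₀ q, H.anti q x₀]; ring
  -- The triangle `x₀ q y₀` is counted in the area, but no choice is made for it and it yields no
  -- sign; the extra summand in the exponent cancels its contribution.
  have e3 : ∀ k l : ℕ, (-1 : F) ^ (k + l + (if Q ∈ σ.black then 1 else 0) +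
      (if Q ∈ σ.black then 1 else 0)) = (-1) ^ k * (-1) ^ l := by
    intro k l
    split_ifs
    · rw [pow_succ, pow_succ, pow_add]; ring
    · rw [add_zero, add_zero, pow_add]
  rw [e3, hval]
  simp only [div_eq_mul_inv, mul_inv]
  field_simp

end ArcPlucker

/-! ### Descents along an arc, areas and orientation -/

section Descents

variable {n : ℕ} [NeZero n]

/-- The position of a letter in a permutation. -/
def permPos (e : Equiv.Perm (Fin n)) (a : Fin n) : ℕ := (e.symm a).val

omit [NeZero n] in
theorem permPos_inj {e : Equiv.Perm (Fin n)} {a b : Fin n} (h : permPos e a = permPos e b) :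
    a = b := e.symm.injective (Fin.ext h)

/-- The number of cyclic descents in a set. -/
def desIn (e : Equiv.Perm (Fin n)) (S : Finset (Fin n)) : ℕ := (S.filter (· ∈ cDes e)).card

theorem sum_indicatorVec (e : Equiv.Perm (Fin n)) (S : Finset (Fin n)) :
    ∑ c ∈ S, indicatorVec (cDes e) c = (desIn e S : ℝ) := by
  simp [indicatorVec, desIn, Finset.filter_mem_eq_inter]

theorem desIn_univ (e : Equiv.Perm (Fin n)) : desIn e Finset.univ = (cDes e).card := by
  simp [desIn]

theorem desIn_union (e : Equiv.Perm (Fin n)) {S T : Finset (Fin n)} (h : Disjoint S T) :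
    desIn e (S ∪ T) = desIn e S + desIn e T := by
  rw [desIn, Finset.filter_union, Finset.card_union_of_disjoint (Finset.disjoint_filter_filter h)]
  rfl

theorem desIn_split (e : Equiv.Perm (Fin n)) {a q b : Fin n} (h : q ∈ openArc a b) :
    desIn e (halfOpenArc a b) = desIn e (halfOpenArc a q) + desIn e (halfOpenArc q b) := by
  rw [(halfOpenArc_split h).2, desIn_union e (halfOpenArc_split h).1]

theorem desIn_compl (e : Equiv.Perm (Fin n)) {a b : Fin n} (h : a ≠ b) :
    desIn e (halfOpenArc a b) + desIn e (halfOpenArc b a) = (cDes e).card := by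
  rw [← desIn_union e (halfOpenArc_compl h).1, (halfOpenArc_compl h).2, desIn_univ]

/-- `1` if `b` precedes `a` and `0` otherwise. -/
def inv01 (e : Equiv.Perm (Fin n)) (a b : Fin n) : ℕ := if permPos e b < permPos e a then 1 else 0

theorem desIn_succ (e : Equiv.Perm (Fin n)) {a : Fin n} (h : a ≠ a + 1) :
    desIn e (halfOpenArc a (a + 1)) = inv01 e a (a + 1) := by
  rw [halfOpenArc_succ h, desIn, inv01, Finset.filter_singleton]
  simp only [cDes, Finset.mem_filter, Finset.mem_univ, true_and, permPos, Fin.val_fin_lt]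
  split_ifs <;> simp

-- `inv01 e a b` tells whether going forward from `a` to `b` passes the end of the word. Going via
-- `q` instead adds one full turn exactly if `q` comes cyclically after `b` and before `a`.
open Classical in
omit [NeZero n] in
theorem inv01_add (e : Equiv.Perm (Fin n)) {a q b : Fin n} (h : a ≠ b) (h1 : a ≠ q) (h2 : q ≠ b) :
    inv01 e a q + inv01 e q b = inv01 e a b +
      if CycOrd (permPos e a) (permPos e b) (permPos e q) then 1 else 0 := by
  have h : permPos e a ≠ permPos e b := fun h' => h (permPos_inj h')
  have h1 : permPos e a ≠ permPos e q := fun h' => h1 (permPos_inj h')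
  have h2 : permPos e q ≠ permPos e b := fun h' => h2 (permPos_inj h')
  unfold inv01 CycOrd
  split_ifs <;> omega

theorem openArc_ne {a q b : Fin n} (h : q ∈ openArc a b) : a ≠ b ∧ a ≠ q ∧ q ≠ b := by
  rw [mem_openArc, CycOrd] at h
  simp only [ne_eq, Fin.ext_iff]
  omega

/-- For permutations with the same cycle, the numbers of descents in an arc differ by the relative
order of its ends. -/
theorem desIn_add_inv01 {e e' : Equiv.Perm (Fin n)}
    (hcyc : ∀ a b c, CycOrd (permPos e a) (permPos e b) (permPos e c) ↔
      CycOrd (permPos e' a) (permPos e' b) (permPos e' c)) (m : ℕ) :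
    ∀ a b : Fin n, (b - a).val = m → a ≠ b →
      desIn e (halfOpenArc a b) + inv01 e' a b = desIn e' (halfOpenArc a b) + inv01 e a b := by
  induction m using Nat.strong_induction_on with
  | _ m ih =>
  intro a b hm hab
  by_cases hb : b = a + 1
  · subst hb
    rw [desIn_succ e hab, desIn_succ e' hab, add_comm]
  -- Splitting off the first step, the corrections from `inv01_add` depend only on the cycle and so
  -- agree for `e` and `e'`.
  · have hq : a + 1 ∈ openArc a b := by
      have := a.isLt; have := b.isLt
      have h1 := Fin.val_ne_of_ne hb
      have h2 := Fin.val_ne_of_ne hab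
      rw [mem_openArc, CycOrd]
      rw [val_add_one] at *
      split_ifs at * <;> omega
    obtain ⟨hlt1, hlt2⟩ := arc_length_lt hq
    obtain ⟨-, h1, h2⟩ := openArc_ne hq
    have i1 := ih _ (hm ▸ hlt1) a (a + 1) rfl h1
    have i2 := ih _ (hm ▸ hlt2) (a + 1) b rfl h2
    have j1 := inv01_add e hab h1 h2
    have j2 := inv01_add e' hab h1 h2
    rw [hcyc] at j1
    rw [desIn_split e hq, desIn_split e' hq]
    omega

variable (σ : BicoloredSubdivision n)

/-- Splitting the arc at a triangle, descents add up, while the area and `inv01` fail to be additive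
by the same amount: one for a black triangle, which is counterclockwise, and zero for a white one.
-/
theorem desIn_eq_of_orientedAll {e : Equiv.Perm (Fin n)} (he : σ.OrientedAll (permPos e)) (m : ℕ) :
    ∀ a b : Fin n, (b - a).val = m → σ.IsCompatible a b →
      desIn e (halfOpenArc a b) = σ.area a b + inv01 e a b := by
  induction m using Nat.strong_induction_on with
  | _ m ih =>
  intro a b hm hcomp
  rcases σ.exists_split hcomp with rfl | ⟨Q, hQ, q, ha, hq', hb, hq⟩
  · rw [desIn_succ e hcomp.1, σ.area_succ, zero_add]
  · obtain ⟨hlt1, hlt2⟩ := arc_length_lt hq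
    obtain ⟨h0, h1, h2⟩ := openArc_ne hq
    have i1 := ih _ (hm ▸ hlt1) a q rfl ⟨h1, Q, hQ, ha, hq'⟩
    have i2 := ih _ (hm ▸ hlt2) q b rfl ⟨h2, Q, hQ, hq', hb⟩
    have j1 := inv01_add e h0 h1 h2
    have hc := he Q hQ a ha q hq' b hb (mem_openArc.mp hq)
    rw [desIn_split e hq, σ.area_split hQ ha hq' hb hq, i1, i2]
    simp only [hc] at j1
    have e1 : (if Q ∈ σ.black then 1 else 0) = (@ite ℕ (Q ∈ σ.black) (Classical.propDecidable _) 1 0) := by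
      congr
    omega

/-- Comparing the formula on the three arcs of a triangle leaves the correction of `inv01_add` equal
to the colour, which determines the orientation. -/
theorem orientedAll_of_desIn_eq {e : Equiv.Perm (Fin n)}
    (h : ∀ a b, σ.IsCompatible a b → desIn e (halfOpenArc a b) = σ.area a b + inv01 e a b) :
    σ.OrientedAll (permPos e) := by
  intro Q hQ a ha q hq' b hb hc
  have hq := mem_openArc.mpr hc
  obtain ⟨h0, h1, h2⟩ := openArc_ne hq
  have i0 := h a b ⟨h0, Q, hQ, ha, hb⟩
  have i1 := h a q ⟨h1, Q, hQ, ha, hq'⟩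
  have i2 := h q b ⟨h2, Q, hQ, hq', hb⟩
  have j1 := inv01_add e h0 h1 h2
  rw [desIn_split e hq, σ.area_split hQ ha hq' hb hq, i1, i2] at i0
  split_ifs at i0 j1 with h3 h4 h4 <;> simp only [h3, h4] <;> omega

omit [NeZero n] in
theorem inv01_swap (e : Equiv.Perm (Fin n)) {a b : Fin n} (h : a ≠ b) :
    inv01 e a b + inv01 e b a = 1 := by
  have h : permPos e a ≠ permPos e b := fun h' => h (permPos_inj h')
  unfold inv01
  split_ifs <;> omega

/-- The formulas for `i → j` and `j → i` add up: the areas to the total area, and the two order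
terms to `1`. -/
theorem card_cDes_of_orientedAll {e : Equiv.Perm (Fin n)} (he : σ.OrientedAll (permPos e))
    {P : Finset (Fin n)} (hP : P ∈ σ.polygons) {i j : Fin n} (hE : IsEdge P j i) :
    (cDes e).card = σ.numBlackTriangles + 1 := by
  have hij : i ≠ j := hE.2.2.1.symm
  rw [← desIn_compl e hij, ← σ.area_add_area hP hE,
    desIn_eq_of_orientedAll σ he _ i j rfl ⟨hij, P, hP, hE.2.1, hE.1⟩,
    desIn_eq_of_orientedAll σ he _ j i rfl ⟨hij.symm, P, hP, hE.1, hE.2.1⟩]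
  have := inv01_swap e hij
  omega

end Descents

/-! ### Vertices of `w`-simplices and the facet criterion -/

section Rotation

variable {n : ℕ} [NeZero n]

theorem rotateTo_symm_apply (w : Equiv.Perm (Fin n)) (r a : Fin n) :
    (rotateTo w r).symm a = w.symm a - (w.symm r + 1) := by
  rw [Equiv.symm_apply_eq]
  change a = w (w.symm a - (w.symm r + 1) + (w.symm r + 1))
  rw [sub_add_cancel, Equiv.apply_symm_apply]

theorem cycOrd_rotateTo (w : Equiv.Perm (Fin n)) (r a b c : Fin n) :
    CycOrd (permPos (rotateTo w r) a) (permPos (rotateTo w r) b) (permPos (rotateTo w r) c) ↔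
      CycOrd (permPos w a) (permPos w b) (permPos w c) := by
  simp only [permPos, rotateTo_symm_apply]
  exact cycOrd_sub _ _ _ _

theorem orientedAll_rotateTo (σ : BicoloredSubdivision n) (w : Equiv.Perm (Fin n)) (r : Fin n) :
    σ.OrientedAll (permPos (rotateTo w r)) ↔ σ.OrientedAll (permPos w) := by
  unfold BicoloredSubdivision.OrientedAll
  simp only [cycOrd_rotateTo]

theorem permPos_rotateTo_self (w : Equiv.Perm (Fin n)) (r : Fin n) :
    permPos (rotateTo w r) r + 1 = n := by
  rw [permPos, rotateTo_symm_apply, val_sub_eq, val_add_one]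
  have := (w.symm r).isLt
  split_ifs <;> omega

theorem permPos_rotateTo_lt (w : Equiv.Perm (Fin n)) {r a : Fin n} (h : a ≠ r) :
    permPos (rotateTo w r) a < permPos (rotateTo w r) r := by
  have h1 := permPos_rotateTo_self w r
  have h2 : permPos (rotateTo w r) a < n := Fin.isLt _
  have h3 : permPos (rotateTo w r) a ≠ permPos (rotateTo w r) r := fun h' => h (permPos_inj h')
  omega

/-- Only the rotation that ends at `i` tears the neighbours `i, j` apart. -/
theorem permPos_rotateTo_precedes {w : Equiv.Perm (Fin n)} {i j r : Fin n} (h : Precedes w i j)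
    (hr : i ≠ r) : permPos (rotateTo w r) j = permPos (rotateTo w r) i + 1 := by
  have h1 := permPos_rotateTo_self w r
  have h2 := permPos_rotateTo_lt w hr
  have h3 : (rotateTo w r).symm j = (rotateTo w r).symm i + 1 := by
    rw [rotateTo_symm_apply, rotateTo_symm_apply, ← h, Equiv.symm_apply_apply,
      add_sub_right_comm]
  have h4 := congrArg Fin.val h3
  rw [val_add_one] at h4
  unfold permPos at *
  split_ifs at h4 <;> omega

theorem rotateTo_trans_swap (w : Equiv.Perm (Fin n)) (i j r : Fin n) :
    rotateTo (w.trans (Equiv.swap i j)) r =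
      (rotateTo w (Equiv.swap i j r)).trans (Equiv.swap i j) := by
  ext x
  simp [rotateTo]

omit [NeZero n] in
theorem permPos_trans_swap (e : Equiv.Perm (Fin n)) (i j a : Fin n) :
    permPos (e.trans (Equiv.swap i j)) a = permPos e (Equiv.swap i j a) := by
  simp [permPos]

omit [NeZero n] in
theorem permPos_swap_lt {e : Equiv.Perm (Fin n)} {i j : Fin n} (h : permPos e j = permPos e i + 1)
    {a b : Fin n} (hab : a ≠ b) (h1 : ¬ (a = i ∧ b = j)) (h2 : ¬ (a = j ∧ b = i)) :
    permPos e (Equiv.swap i j a) < permPos e (Equiv.swap i j b) ↔ permPos e a < permPos e b := by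
  have inj : ∀ {a b}, a ≠ b → permPos e a ≠ permPos e b := fun h h' => h (permPos_inj h')
  have hij : i ≠ j := by rintro rfl; omega
  rcases eq_or_ne a i with rfl | hai
  · have hbj : b ≠ j := fun h' => h1 ⟨rfl, h'⟩
    rw [Equiv.swap_apply_left, Equiv.swap_apply_of_ne_of_ne hab.symm hbj]
    have := inj hab; have := inj hbj
    omega
  rcases eq_or_ne a j with rfl | haj
  · have hbi : b ≠ i := fun h' => h2 ⟨rfl, h'⟩
    rw [Equiv.swap_apply_right, Equiv.swap_apply_of_ne_of_ne hbi hab.symm]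
    have := inj hab; have := inj hbi
    omega
  rw [Equiv.swap_apply_of_ne_of_ne hai haj]
  have := inj hai; have := inj haj
  rcases eq_or_ne b i with rfl | hbi
  · rw [Equiv.swap_apply_left]; omega
  rcases eq_or_ne b j with rfl | hbj
  · rw [Equiv.swap_apply_right]; omega
  rw [Equiv.swap_apply_of_ne_of_ne hbi hbj]

/-- Swapping adjacent letters changes only their own relative order, which no descent sees because
`i` and `j` are not cyclically consecutive. -/
theorem cDes_trans_swap {e : Equiv.Perm (Fin n)} {i j : Fin n} (hij : IsInternal i j)
    (h : permPos e j = permPos e i + 1) : cDes (e.trans (Equiv.swap i j)) = cDes e := by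
  ext c
  have hn : c + 1 ≠ c := by
    have h0 := Fin.val_ne_of_ne hij.1
    have := i.isLt; have := j.isLt; have := c.isLt
    intro h
    have h := congrArg Fin.val h
    rw [val_add_one] at h
    split_ifs at h <;> omega
  have := permPos_swap_lt h hn (fun h => hij.2.2 (h.2 ▸ h.1.symm))
    (fun h => hij.2.1 (h.2 ▸ h.1.symm))
  simp only [cDes, Finset.mem_filter, Finset.mem_univ, true_and, Fin.lt_def]
  change permPos (e.trans (Equiv.swap i j)) (c + 1) < permPos (e.trans (Equiv.swap i j)) c ↔
    permPos e (c + 1) < permPos e c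
  rwa [permPos_trans_swap, permPos_trans_swap]

/-- These vertices of the common facet suffice to test its containment in the tile facet. -/
theorem mem_wFacet {w : Equiv.Perm (Fin n)} {i j r : Fin n} (hij : IsInternal i j)
    (h : Precedes w i j) (hr : i ≠ r) : indicatorVec (cDes (rotateTo w r)) ∈ wFacet w i j := by
  refine ⟨subset_convexHull ℝ _ ⟨r, rfl⟩,
    subset_convexHull ℝ _ ⟨Equiv.swap i j r, ?_⟩⟩
  simp only
  rw [rotateTo_trans_swap, Equiv.swap_apply_self,
    cDes_trans_swap hij (permPos_rotateTo_precedes h hr)]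

theorem sum_le_of_mem_wSimplex {w : Equiv.Perm (Fin n)} {x : Fin n → ℝ} (hx : x ∈ wSimplex w)
    (S : Finset (Fin n)) (m : ℕ) (h : ∀ r, desIn (rotateTo w r) S ≤ m) : ∑ c ∈ S, x c ≤ m := by
  have hlin : IsLinearMap ℝ fun x : Fin n → ℝ => ∑ c ∈ S, x c :=
    ⟨fun x y => by simp [Finset.sum_add_distrib], fun a x => by simp [Finset.mul_sum]⟩
  refine convexHull_min (t := {x : Fin n → ℝ | ∑ c ∈ S, x c ≤ m}) ?_
    (convex_halfSpace_le hlin _) hx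
  rintro _ ⟨r, rfl⟩
  simp only [Set.mem_ofPred_eq]
  rw [sum_indicatorVec]
  exact_mod_cast h r

theorem le_sum_of_mem_wSimplex {w : Equiv.Perm (Fin n)} {x : Fin n → ℝ} (hx : x ∈ wSimplex w)
    (S : Finset (Fin n)) (m : ℕ) (h : ∀ r, m ≤ desIn (rotateTo w r) S) : m ≤ ∑ c ∈ S, x c := by
  have hlin : IsLinearMap ℝ fun x : Fin n → ℝ => ∑ c ∈ S, x c :=
    ⟨fun x y => by simp [Finset.sum_add_distrib], fun a x => by simp [Finset.mul_sum]⟩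
  refine convexHull_min (t := {x : Fin n → ℝ | m ≤ ∑ c ∈ S, x c}) ?_
    (convex_halfSpace_ge hlin _) hx
  rintro _ ⟨r, rfl⟩
  simp only [Set.mem_ofPred_eq]
  rw [sum_indicatorVec]
  exact_mod_cast h r

omit [NeZero n] in
theorem inv01_le_one (e : Equiv.Perm (Fin n)) (a b : Fin n) : inv01 e a b ≤ 1 := by
  unfold inv01; split_ifs <;> omega

variable {σ : BicoloredSubdivision n} {i j : Fin n}

/-- The descent formula holds in all rotations, so the vertices of `wSimplex w` satisfy the tile
inequalities. The facet equation needs in addition an upper bound on `[i, j - 1]`, which comes from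
the simplex of the swapped word. -/
theorem wFacet_subset_of_orientedAll (hij : IsInternal i j) {P : Finset (Fin n)}
    (hP : P ∈ σ.polygons) (hE : IsEdge P j i) {w : Equiv.Perm (Fin n)} (hw : Precedes w i j)
    (h : σ.OrientedAll (permPos w)) : wFacet w i j ⊆ tileFacet σ i j := by
  have hr : ∀ r, σ.OrientedAll (permPos (rotateTo w r)) := fun r =>
    (orientedAll_rotateTo σ w r).mpr h
  have hdes := fun r a b hab => desIn_eq_of_orientedAll σ (hr r) _ a b rfl hab
  have hcij : σ.IsCompatible i j := ⟨hij.1, P, hP, hE.2.1, hE.1⟩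
  rintro x ⟨hxw, hxu⟩
  have hlow : ∀ a b, σ.IsCompatible a b → (σ.area a b : ℝ) ≤ ∑ c ∈ halfOpenArc a b, x c :=
    fun a b hab => le_sum_of_mem_wSimplex hxw _ _ fun r => by rw [hdes r a b hab]; omega
  refine ⟨⟨?_, fun a b hab => ⟨hlow a b hab, ?_⟩⟩, le_antisymm ?_ (hlow i j hcij)⟩
  · have h1 : ∀ r, desIn (rotateTo w r) Finset.univ = σ.numBlackTriangles + 1 := fun r => by
      rw [desIn_univ, card_cDes_of_orientedAll σ (hr r) hP hE]
    have h2 := sum_le_of_mem_wSimplex hxw Finset.univ _ fun r => (h1 r).le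
    have h3 := le_sum_of_mem_wSimplex hxw Finset.univ _ fun r => (h1 r).ge
    push_cast at h2 h3
    exact le_antisymm h2 h3
  · have := sum_le_of_mem_wSimplex hxw (halfOpenArc a b) (σ.area a b + 1) fun r => by
      rw [hdes r a b hab]
      have := inv01_le_one (rotateTo w r) a b
      omega
    exact_mod_cast this
  -- In the rotation of `u` that ends at `i`, the descent set is that of the rotation of `w` ending
  -- at `j`, so the count is the area although `j` precedes `i`. By `desIn_add_inv01` no other
  -- rotation of `u` can exceed it.
  · refine sum_le_of_mem_wSimplex hxu _ _ fun r => ?_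
    set u := w.trans (Equiv.swap i j)
    have hcyc : ∀ a b c, CycOrd (permPos (rotateTo u r) a) (permPos (rotateTo u r) b)
        (permPos (rotateTo u r) c) ↔ CycOrd (permPos (rotateTo u i) a)
          (permPos (rotateTo u i) b) (permPos (rotateTo u i) c) := fun a b c => by
      rw [cycOrd_rotateTo, cycOrd_rotateTo]
    have key := desIn_add_inv01 hcyc _ i j rfl hij.1
    have hru : rotateTo u i = (rotateTo w j).trans (Equiv.swap i j) := by
      rw [rotateTo_trans_swap, Equiv.swap_apply_left]
    have hpre := permPos_rotateTo_precedes hw hij.1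
    have e1 : inv01 (rotateTo u i) i j = 1 := by
      rw [inv01, if_pos (permPos_rotateTo_lt u hij.1.symm)]
    have e2 : desIn (rotateTo u i) (halfOpenArc i j) = σ.area i j := by
      rw [desIn, hru, cDes_trans_swap hij hpre]
      have := hdes j i j hcij
      rw [inv01, if_neg (by omega), add_zero] at this
      exact this
    have e3 := inv01_le_one (rotateTo u r) i j
    omega

/-- The inequalities at the vertices of the facet pin down the number of descents on every
compatible arc, so that `orientedAll_of_desIn_eq` applies. -/
theorem orientedAll_of_wFacet_subset (hij : IsInternal i j) {P : Finset (Fin n)}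
    (hP : P ∈ σ.polygons) (hE : IsEdge P j i) {w : Equiv.Perm (Fin n)} (hw : Precedes w i j)
    (h : wFacet w i j ⊆ tileFacet σ i j) : σ.OrientedAll (permPos w) := by
  have hv := fun r (hr : i ≠ r) => h (mem_wFacet hij hw hr)
  have htot : (cDes (rotateTo w j)).card = σ.numBlackTriangles + 1 := by
    have := (hv j hij.1).1.1
    rw [sum_indicatorVec, desIn_univ] at this
    exact_mod_cast this
  have hfac : desIn (rotateTo w j) (halfOpenArc i j) = σ.area i j := by
    have := (hv j hij.1).2
    rw [sum_indicatorVec] at this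
    exact_mod_cast this
  have hineq : ∀ r, i ≠ r → ∀ a b, σ.IsCompatible a b →
      σ.area a b ≤ desIn (rotateTo w r) (halfOpenArc a b) ∧
        desIn (rotateTo w r) (halfOpenArc a b) ≤ σ.area a b + 1 := by
    intro r hr a b hab
    have := (hv r hr).1.2 a b hab
    rw [sum_indicatorVec] at this
    exact_mod_cast this
  have hrot : ∀ r r' a b, a ≠ b → desIn (rotateTo w r) (halfOpenArc a b) +
      inv01 (rotateTo w r') a b = desIn (rotateTo w r') (halfOpenArc a b) +
      inv01 (rotateTo w r) a b := fun r r' a b hab =>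
    desIn_add_inv01 (fun a b c => by rw [cycOrd_rotateTo, cycOrd_rotateTo]) _ a b rfl hab
  have hpre := permPos_rotateTo_precedes hw hij.1
  rw [← orientedAll_rotateTo σ w j]
  refine orientedAll_of_desIn_eq σ fun a b hab => ?_
  by_cases h1 : a = i ∧ b = j
  · obtain ⟨rfl, rfl⟩ := h1
    rw [hfac, inv01, if_neg (by omega), add_zero]
  -- For `j → i` the count is the complement of the one for `i → j` in the total.
  by_cases h2 : a = j ∧ b = i
  · obtain ⟨rfl, rfl⟩ := h2
    have e1 := desIn_compl (rotateTo w a) hij.1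
    have e2 := σ.area_add_area hP hE
    rw [inv01, if_pos (by omega)]
    omega
  have hlt : ∀ c, c ≠ i → c ≠ j → permPos (rotateTo w j) c < permPos (rotateTo w j) i := by
    intro c hci hcj
    have e1 := permPos_rotateTo_lt w hcj
    have e2 : permPos (rotateTo w j) c ≠ permPos (rotateTo w j) i := fun h => hci (permPos_inj h)
    omega
  -- Both relative orders of `a` and `b` occur in rotations that do not end at `i`; where `i` would
  -- be the last letter, the rotation ending `… i j` serves instead. The two counts differ by one,
  -- so the bounds `area` and `area + 1` are both attained.
  obtain ⟨r₁, hr₁, hlt₁⟩ : ∃ r, i ≠ r ∧ permPos (rotateTo w r) b < permPos (rotateTo w r) a := by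
    by_cases hai : a = i
    · refine ⟨j, hij.1, ?_⟩
      rw [hai]
      exact hlt b (fun h => hab.1 (hai.trans h.symm)) (fun h => h1 ⟨hai, h⟩)
    · exact ⟨a, Ne.symm hai, permPos_rotateTo_lt w hab.1.symm⟩
  obtain ⟨r₂, hr₂, hlt₂⟩ : ∃ r, i ≠ r ∧ permPos (rotateTo w r) a < permPos (rotateTo w r) b := by
    by_cases hbi : b = i
    · refine ⟨j, hij.1, ?_⟩
      rw [hbi]
      exact hlt a (fun h => hab.1 (h.trans hbi.symm)) (fun h => h2 ⟨h, hbi⟩)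
    · exact ⟨b, Ne.symm hbi, permPos_rotateTo_lt w hab.1⟩
  have k1 := hineq r₁ hr₁ a b hab
  have k2 := hineq r₂ hr₂ a b hab
  have k3 := hrot r₁ r₂ a b hab.1
  have k4 := hrot j r₂ a b hab.1
  have i1 : inv01 (rotateTo w r₁) a b = 1 := if_pos hlt₁
  have i2 : inv01 (rotateTo w r₂) a b = 0 := if_neg (by omega)
  omega

/-- Compatibility also forces the number of descents, so it replaces both geometric conditions in
the weight function. -/
theorem facet_condition_iff (hij : IsInternal i j) {P : Finset (Fin n)}
    (hP : P ∈ σ.polygons) (hE : IsEdge P j i) {w : Equiv.Perm (Fin n)} (hw : Precedes w i j) :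
    (cDes w).card = σ.numBlackTriangles + 1 ∧ wFacet w i j ⊆ tileFacet σ i j ↔
      σ.OrientedAll (permPos w) :=
  ⟨fun h => orientedAll_of_wFacet_subset hij hP hE hw h.2, fun h =>
    ⟨card_cDes_of_orientedAll σ h hP hE, wFacet_subset_of_orientedAll hij hP hE hw h⟩⟩

end Rotation

/-! ### Shuffles of two words -/

section Shuffles

variable {α : Type*} [DecidableEq α]

/-- The shuffles of two words. -/
def shuffles : List α → List α → Finset (List α)
  | [], t => {t}
  | a :: s, [] => {a :: s}
  | a :: s, b :: t =>
    (shuffles s (b :: t)).image (a :: ·) ∪ (shuffles (a :: s) t).image (b :: ·)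
termination_by s t => s.length + t.length

theorem mem_shuffles {q : α → Bool} : ∀ {s t l : List α}, (∀ x ∈ s, q x = true) →
    (∀ x ∈ t, q x = false) →
    (l ∈ shuffles s t ↔ l.filter q = s ∧ l.filter (fun x => !q x) = t)
  | [], t, l, _, ht => by
      rw [shuffles, Finset.mem_singleton]
      constructor
      · rintro rfl
        exact ⟨List.filter_eq_nil_iff.mpr fun x hx => by simp [ht x hx],
          List.filter_eq_self.mpr fun x hx => by simp [ht x hx]⟩
      · rintro ⟨h1, h2⟩
        rw [← h2]
        exact (List.filter_eq_self.mpr fun x hx => by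
          simpa using List.filter_eq_nil_iff.mp h1 x hx).symm
  | a :: s, [], l, hs, _ => by
      rw [shuffles, Finset.mem_singleton]
      constructor
      · rintro rfl
        exact ⟨List.filter_eq_self.mpr hs,
          List.filter_eq_nil_iff.mpr fun x hx => by simp [hs x hx]⟩
      · rintro ⟨h1, h2⟩
        rw [← h1]
        exact (List.filter_eq_self.mpr fun x hx => by
          simpa using List.filter_eq_nil_iff.mp h2 x hx).symm
  | a :: s, b :: t, l, hs, ht => by
      have ha := hs a (by simp)
      have hb := ht b (by simp)
      have ih1 := fun l => mem_shuffles (q := q) (s := s) (t := b :: t) (l := l)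
        (fun x hx => hs x (by simp [hx])) ht
      have ih2 := fun l => mem_shuffles (q := q) (s := a :: s) (t := t) (l := l)
        hs (fun x hx => ht x (by simp [hx]))
      rw [shuffles, Finset.mem_union, Finset.mem_image, Finset.mem_image]
      constructor
      · rintro (⟨l', hl', rfl⟩ | ⟨l', hl', rfl⟩)
        · rw [ih1] at hl'
          simp [ha, hl'.1, hl'.2]
        · rw [ih2] at hl'
          simp [hb, hl'.1, hl'.2]
      · rintro ⟨h1, h2⟩
        cases l with
        | nil => simp at h1
        | cons x l =>
          cases hx : q x
          · rw [List.filter_cons_of_neg (by simp [hx])] at h1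
            rw [List.filter_cons_of_pos (by simp [hx]), List.cons.injEq] at h2
            exact Or.inr ⟨l, (ih2 l).mpr ⟨h1, h2.2⟩, by rw [h2.1]⟩
          · rw [List.filter_cons_of_pos (by simp [hx]), List.cons.injEq] at h1
            rw [List.filter_cons_of_neg (by simp [hx])] at h2
            exact Or.inl ⟨l, (ih1 l).mpr ⟨h1.2, h2⟩, by rw [h1.1]⟩
termination_by s t => s.length + t.length

/-- Pascal's rule, according to the word from which the first letter comes. The predicate `q` keeps
the two alphabets apart, so the two cases are disjoint. -/
theorem card_shuffles {q : α → Bool} : ∀ {s t : List α}, (∀ x ∈ s, q x = true) →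
    (∀ x ∈ t, q x = false) → (shuffles s t).card = (s.length + t.length).choose s.length
  | [], t, _, _ => by rw [shuffles]; simp
  | a :: s, [], _, _ => by rw [shuffles]; simp
  | a :: s, b :: t, hs, ht => by
      have hab : a ≠ b := by
        rintro rfl
        simpa [hs a (by simp)] using ht a (by simp)
      have ih1 := card_shuffles (q := q) (s := s) (t := b :: t)
        (fun x hx => hs x (by simp [hx])) ht
      have ih2 := card_shuffles (q := q) (s := a :: s) (t := t)
        hs (fun x hx => ht x (by simp [hx]))
      rw [shuffles, Finset.card_union_of_disjoint,
        Finset.card_image_of_injective _ (List.cons_injective),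
        Finset.card_image_of_injective _ (List.cons_injective), ih1, ih2]
      · simp only [List.length_cons]
        rw [show s.length + 1 + (t.length + 1) = (s.length + t.length + 1) + 1 by ring,
          Nat.choose_succ_succ]
        congr 2
        ring
      · rw [Finset.disjoint_left]
        intro l h1 h2
        rw [Finset.mem_image] at h1 h2
        obtain ⟨l1, _, rfl⟩ := h1
        obtain ⟨l2, _, h⟩ := h2
        exact hab (List.cons.inj h).1.symm
termination_by s t => s.length + t.length

theorem length_of_mem_words {A : Finset α} {l : List α} (h : l ∈ words A) :
    l.length = A.card := by
  rw [← (mem_words.mp h).2, List.toFinset_card_of_nodup (mem_words.mp h).1]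

theorem card_words_restrict {A B : Finset α} (hd : Disjoint A B) {u v : List α} (hu : u ∈ words A)
    (hv : v ∈ words B) : ((words (A ∪ B)).filter fun l => l.filter (· ∈ A) = u ∧
      l.filter (· ∈ B) = v).card = (A.card + B.card).choose A.card := by
  have hu' : ∀ x ∈ u, decide (x ∈ A) = true := fun x hx => by
    simpa using (mem_of_mem_words hu).mp hx
  have hv' : ∀ x ∈ v, decide (x ∈ A) = false := fun x hx => by
    simpa using Finset.disjoint_right.mp hd ((mem_of_mem_words hv).mp hx)
  rw [← length_of_mem_words hu, ← length_of_mem_words hv, ← card_shuffles hu' hv']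
  congr 1
  ext l
  rw [mem_shuffles hu' hv', Finset.mem_filter]
  have key : ∀ l : List α, (∀ x ∈ l, x ∈ A ∪ B) →
      l.filter (fun x => !decide (x ∈ A)) = l.filter (· ∈ B) := by
    intro l hl
    refine List.filter_congr fun x hx => ?_
    rcases Finset.mem_union.mp (hl x hx) with h | h
    · simp [h, Finset.disjoint_left.mp hd h]
    · simp [h, Finset.disjoint_right.mp hd h]
  constructor
  · rintro ⟨hl, h1, h2⟩
    exact ⟨h1, by rw [key l fun x hx => (mem_of_mem_words hl).mp hx, h2]⟩
  · rintro ⟨h1, h2⟩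
    have hp : l.Perm (u ++ v) := by
      rw [← h1, ← h2]; exact (List.filter_append_perm _ l).symm
    have hl : l ∈ words (A ∪ B) := by
      rw [mem_words, hp.nodup_iff, List.toFinset_eq_of_perm _ _ hp, List.toFinset_append,
        (mem_words.mp hu).2, (mem_words.mp hv).2, List.nodup_append']
      refine ⟨⟨(mem_words.mp hu).1, (mem_words.mp hv).1, ?_⟩, rfl⟩
      intro x hx hx'
      exact Finset.disjoint_left.mp hd ((mem_of_mem_words hu).mp hx) ((mem_of_mem_words hv).mp hx')
    exact ⟨hl, h1, by rw [← key l fun x hx => (mem_of_mem_words hl).mp hx, h2]⟩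

/-- The summand and the conditions depend only on the two restrictions, and every pair of
restrictions has the same number of shuffles. -/
theorem sum_words_union {F : Type*} [Field F] {A B : Finset α} (hd : Disjoint A B)
    (c₁ c₂ : List α → Prop) [DecidablePred c₁] [DecidablePred c₂] (f g : List α → F) :
    ∑ l ∈ words (A ∪ B) with c₁ (l.filter (· ∈ A)) ∧ c₂ (l.filter (· ∈ B)),
        f (l.filter (· ∈ A)) * g (l.filter (· ∈ B)) =
      ((A.card + B.card).choose A.card : F) * (∑ u ∈ words A with c₁ u, f u) *
        ∑ v ∈ words B with c₂ v, g v := by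
  rw [← Finset.sum_fiberwise_of_maps_to
    (g := fun l : List α => (l.filter (· ∈ A), l.filter (· ∈ B)))
    (t := (words A).filter c₁ ×ˢ (words B).filter c₂), mul_assoc, Finset.sum_mul_sum,
    ← Finset.sum_product', Finset.mul_sum]
  · refine Finset.sum_congr rfl fun z hz => ?_
    rw [Finset.mem_product, Finset.mem_filter, Finset.mem_filter] at hz
    rw [← card_words_restrict hd hz.1.1 hz.2.1, ← nsmul_eq_mul, ← Finset.sum_const]
    refine Finset.sum_congr ?_ ?_
    · ext l
      simp only [Finset.mem_filter, Prod.ext_iff]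
      constructor
      · rintro ⟨⟨h, _⟩, h'⟩; exact ⟨h, h'⟩
      · rintro ⟨h, h'⟩; exact ⟨⟨h, by rw [h'.1, h'.2]; exact ⟨hz.1.2, hz.2.2⟩⟩, h'⟩
    · intro l hl
      simp only [Finset.mem_filter] at hl
      rw [← hl.2.1, ← hl.2.2]
  · intro l hl
    rw [Finset.mem_filter] at hl
    rw [Finset.mem_product, Finset.mem_filter, Finset.mem_filter]
    exact ⟨⟨filter_mem_words Finset.subset_union_left hl.1, hl.2.1⟩,
      ⟨filter_mem_words Finset.subset_union_right hl.1, hl.2.2⟩⟩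

end Shuffles

/-! ### Cutting the cycle between `i` and `j` -/

section Unroll

variable {n : ℕ} [NeZero n]

theorem rotateTo_rotateTo (w : Equiv.Perm (Fin n)) (r r' : Fin n) :
    rotateTo (rotateTo w r) r' = rotateTo w r' := by
  apply Equiv.ext
  intro x
  change w (x + ((rotateTo w r).symm r' + 1) + (w.symm r + 1)) = w (x + (w.symm r' + 1))
  rw [rotateTo_symm_apply]
  congr 1
  abel

theorem rev_zero_add_one : (Fin.rev 0 : Fin n) + 1 = 0 := by
  have := NeZero.pos n
  apply Fin.ext
  rw [val_add_one, Fin.val_rev, Fin.val_zero]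
  split_ifs <;> omega

theorem rotateTo_apply_last (w : Equiv.Perm (Fin n)) (r : Fin n) :
    rotateTo w r (Fin.rev 0) = r := by
  change w (Fin.rev 0 + (w.symm r + 1)) = r
  rw [add_left_comm, rev_zero_add_one, add_zero, Equiv.apply_symm_apply]

theorem rotateTo_last (w : Equiv.Perm (Fin n)) : rotateTo w (w (Fin.rev 0)) = w := by
  apply Equiv.ext
  intro x
  change w (x + (w.symm (w (Fin.rev 0)) + 1)) = w x
  rw [Equiv.symm_apply_apply, rev_zero_add_one, add_zero]

theorem rotateTo_apply_zero (w : Equiv.Perm (Fin n)) (i : Fin n) :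
    rotateTo w i 0 = w (w.symm i + 1) := by
  change w (0 + (w.symm i + 1)) = _
  rw [zero_add]

theorem ofFn_isRotated (w : Equiv.Perm (Fin n)) (r : Fin n) :
    List.ofFn w ~r List.ofFn (rotateTo w r) := by
  refine ⟨(w.symm r + 1).val, ?_⟩
  apply List.ext_getElem
  · simp
  · intro k h1 h2
    rw [List.getElem_rotate, List.getElem_ofFn, List.getElem_ofFn]
    have hk : k < n := by simpa using h2
    change _ = w (⟨k, hk⟩ + (w.symm r + 1))
    congr 1
    apply Fin.ext
    refine Eq.trans ?_ (Fin.val_add _ _).symm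
    simp only [List.length_ofFn]

theorem openArc_union {i j : Fin n} (h : i ≠ j) : Disjoint (openArc i j) (openArc j i) ∧
    openArc i j ∪ openArc j i = Finset.univ \ {i, j} := by
  have h := Fin.val_ne_of_ne h
  constructor
  · rw [Finset.disjoint_left]
    intro x
    simp only [mem_openArc, CycOrd]
    omega
  · ext x
    simp only [Finset.mem_union, mem_openArc, CycOrd, Finset.mem_sdiff, Finset.mem_univ,
      true_and, Finset.mem_insert, Finset.mem_singleton, Fin.ext_iff]
    omega

/-- The word of a permutation that starts with `j` and ends with `i`. -/
theorem exists_word {i j : Fin n} (hij : i ≠ j) {e : Equiv.Perm (Fin n)} (h0 : e 0 = j)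
    (hl : e (Fin.rev 0) = i) :
    ∃ v ∈ words (openArc i j ∪ openArc j i), List.ofFn e = j :: (v ++ [i]) := by
  have hn : 2 ≤ n := by
    have := i.isLt; have := j.isLt; have := Fin.val_ne_of_ne hij; omega
  have hlen : (List.ofFn e).length = n := by simp
  have hne : List.ofFn e ≠ [] := by intro h; rw [h] at hlen; simp at hlen; omega
  have hhead : (List.ofFn e).head hne = j := by
    rw [← h0, List.head_eq_getElem, List.getElem_ofFn]; rfl
  have hlast : (List.ofFn e).getLast hne = i := by
    rw [← hl, List.getLast_eq_getElem, List.getElem_ofFn]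
    congr 1
    apply Fin.ext
    simp [Fin.val_rev]
  obtain ⟨l, hl'⟩ : ∃ l, List.ofFn e = j :: l :=
    ⟨(List.ofFn e).tail, by rw [← hhead, List.cons_head_tail]⟩
  have hlne : l ≠ [] := by
    rintro rfl; rw [hl'] at hlen; simp at hlen; omega
  have hli : l.getLast hlne = i := by
    rw [← hlast]; simp only [hl']; rw [List.getLast_cons hlne]
  have hldec : l = l.dropLast ++ [i] := by
    conv_lhs => rw [← List.dropLast_append_getLast hlne, hli]
  refine ⟨l.dropLast, ?_, by rw [hl', ← hldec]⟩
  have hnd : (j :: (l.dropLast ++ [i])).Nodup := by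
    rw [← hldec, ← hl', List.nodup_ofFn]; exact e.injective
  rw [List.nodup_cons, ← List.concat_eq_append, List.nodup_concat] at hnd
  rw [mem_words, (openArc_union hij).2]
  refine ⟨hnd.2.2, ?_⟩
  ext x
  have hx : x ∈ j :: (l.dropLast ++ [i]) := by
    rw [← hldec, ← hl', List.mem_ofFn]; exact ⟨e.symm x, by simp⟩
  simp only [List.mem_toFinset, Finset.mem_sdiff, Finset.mem_univ, true_and, Finset.mem_insert,
    Finset.mem_singleton, not_or]
  constructor
  · intro hx'
    exact ⟨by rintro rfl; exact hnd.2.1 hx',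
      by rintro rfl; exact hnd.1 (by simp [List.concat_eq_append, hx'])⟩
  · rintro ⟨h1, h2⟩
    simpa [h1, h2] using hx

theorem exists_perm_of_word {i j : Fin n} (hij : i ≠ j) {v : List (Fin n)}
    (hv : v ∈ words (openArc i j ∪ openArc j i)) :
    ∃ e : Equiv.Perm (Fin n), List.ofFn e = j :: (v ++ [i]) ∧ e 0 = j ∧ e (Fin.rev 0) = i := by
  set l := j :: (v ++ [i]) with hl
  rw [(openArc_union hij).2] at hv
  have hmem : ∀ x, x ∈ v ↔ x ≠ i ∧ x ≠ j := fun x => by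
    rw [mem_of_mem_words hv]; simp
  have hnd : l.Nodup := by
    rw [hl, List.nodup_cons, List.mem_append, List.mem_singleton, hmem,
      ← List.concat_eq_append, List.nodup_concat, hmem]
    exact ⟨fun h => h.elim (fun h => h.2 rfl) hij.symm, fun h => h.1 rfl, (mem_words.mp hv).1⟩
  have hall : ∀ x, x ∈ l := fun x => by
    simp only [hl, List.mem_cons, List.mem_append, List.not_mem_nil, or_false, hmem]; tauto
  have hlen : l.length = n := by
    rw [← List.toFinset_card_of_nodup hnd,
      Finset.eq_univ_iff_forall.mpr fun x => List.mem_toFinset.mpr (hall x), Finset.card_univ,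
      Fintype.card_fin]
  set e : Equiv.Perm (Fin n) :=
    (finCongr hlen.symm).trans (hnd.getEquivOfForallMemList l hall) with he
  have hget : ∀ k : Fin n, e k = l[k.val]'(by rw [hlen]; exact k.isLt) := fun k => rfl
  refine ⟨e, ?_, ?_, ?_⟩
  · apply List.ext_getElem
    · rw [List.length_ofFn, hlen]
    · intro k h1 h2
      rw [List.getElem_ofFn, hget]
  · rw [hget]; simp [hl]
  · rw [hget]
    have h1 : v.length + 2 = n := by simpa [hl] using hlen
    have h2 : (Fin.rev 0 : Fin n).val = v.length + 1 := by
      rw [Fin.val_rev, Fin.val_zero]; omega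
    simp only [h2, hl]
    simp

omit [NeZero n] in
theorem permPos_eq_wordPos {i j : Fin n} {e : Equiv.Perm (Fin n)} {v : List (Fin n)}
    (h : List.ofFn e = j :: (v ++ [i])) : permPos e = wordPos j i v := by
  funext a
  rw [wordPos, ← h, permPos]
  have hnd : (List.ofFn e).Nodup := List.nodup_ofFn.mpr e.injective
  have hlt : (e.symm a).val < (List.ofFn e).length := by simp
  have hget : (List.ofFn e)[(e.symm a).val] = a := by simp
  conv_rhs => rw [← hget]
  rw [hnd.idxOf_getElem]

-- The rotation of `w` ending at `i` has the form `j v i`. Conversely `v` determines the cycle, and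
-- the normalisation that the largest letter is last selects one permutation from it.
open Classical in
theorem sum_perm_eq_sum_words {M : Type*} [AddCommMonoid M] {i j : Fin n} (hij : i ≠ j)
    (c : Equiv.Perm (Fin n) → Prop) (c' : List (Fin n) → Prop) (f : Equiv.Perm (Fin n) → M) (g : List (Fin n) → M)
    (hc : ∀ w v, v ∈ words (openArc i j ∪ openArc j i) →
      List.ofFn (rotateTo w i) = j :: (v ++ [i]) → (c w ↔ c' v))
    (hf : ∀ w v, v ∈ words (openArc i j ∪ openArc j i) →
      List.ofFn (rotateTo w i) = j :: (v ++ [i]) → f w = g v) :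
    ∑ w : Equiv.Perm (Fin n) with (w (Fin.rev 0) = Fin.rev 0 ∧ Precedes w i j) ∧ c w, f w =
      ∑ v ∈ words (openArc i j ∪ openArc j i) with c' v, g v := by
  have hex : ∀ w : Equiv.Perm (Fin n), Precedes w i j →
      ∃ v ∈ words (openArc i j ∪ openArc j i), List.ofFn (rotateTo w i) = j :: (v ++ [i]) :=
    fun w hw => exists_word hij ((rotateTo_apply_zero w i).trans hw) (rotateTo_apply_last w i)
  refine Finset.sum_bij (fun w _ => (List.ofFn (rotateTo w i)).tail.dropLast) ?_ ?_ ?_ ?_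
  · intro w hw
    simp only [Finset.mem_filter, Finset.mem_univ, true_and] at hw
    obtain ⟨v, hv, h⟩ := hex w hw.1.2
    rw [h, List.tail_cons, List.dropLast_concat, Finset.mem_filter]
    exact ⟨hv, (hc w v hv h).mp hw.2⟩
  · intro w hw w' hw' heq
    simp only [Finset.mem_filter, Finset.mem_univ, true_and] at hw hw'
    obtain ⟨v, hv, h⟩ := hex w hw.1.2
    obtain ⟨v', hv', h'⟩ := hex w' hw'.1.2
    simp only [h, h', List.tail_cons, List.dropLast_concat] at heq
    rw [heq, ← h'] at h
    have h : rotateTo w i = rotateTo w' i := Equiv.coe_fn_injective (List.ofFn_injective h)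
    rw [← rotateTo_last w, ← rotateTo_last w', hw.1.1, hw'.1.1, ← rotateTo_rotateTo w i, h,
      rotateTo_rotateTo]
  · intro v hv
    rw [Finset.mem_filter] at hv
    obtain ⟨e, he, h0, hl⟩ := exists_perm_of_word hij hv.1
    -- The preimage of `v` is the rotation of `j v i` that ends with the largest letter.
    have hrot : rotateTo (rotateTo e (Fin.rev 0)) i = e := by
      rw [rotateTo_rotateTo]; conv_lhs => rw [← hl, rotateTo_last]
    refine ⟨rotateTo e (Fin.rev 0), ?_, ?_⟩
    · simp only [Finset.mem_filter, Finset.mem_univ, true_and]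
      refine ⟨⟨rotateTo_apply_last _ _, ?_⟩, (hc _ v hv.1 (by rw [hrot, he])).mpr hv.2⟩
      rw [Precedes, ← rotateTo_apply_zero, hrot, h0]
    · simp only [hrot, he, List.tail_cons, List.dropLast_concat]
  · intro w hw
    simp only [Finset.mem_filter, Finset.mem_univ, true_and] at hw
    obtain ⟨v, hv, h⟩ := hex w hw.1.2
    simp only [h, List.tail_cons, List.dropLast_concat]
    exact hf w v hv h

end Unroll

/-! ### Parke–Taylor functions as inverse chain products -/

section ParkeTaylorFunctions

variable {N F : Type} [Field F]

theorem PT_eq_of_isRotated (P : N → N → F) {u v : List N} (h : u ~r v) : PT P u = PT P v := by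
  obtain ⟨m, rfl⟩ := h
  rw [PT, PT, List.rotate_rotate, Nat.add_comm, ← List.rotate_rotate,
    ← List.zipWith_rotate_distrib _ _ _ _ (by simp)]
  rw [(List.rotate_perm _ _).prod_eq]

omit [Field F] in
theorem zipWith_cons_append (P : N → N → F) (x y : N) (u : List N) :
    List.zipWith P (x :: u ++ [y]) (u ++ [y]) = List.zipWith P (x :: u) (u ++ [y]) := by
  rw [← List.append_nil (u ++ [y]), List.zipWith_append (by simp)]
  simp

theorem PT_cons (P : N → N → F) (x : N) (u : List N) :
    PT P (x :: u) = (chainProd P (x :: (u ++ [x])))⁻¹ := by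
  rw [PT, one_div, chainProd, List.tail_cons, ← List.cons_append, zipWith_cons_append]
  simp

theorem chainProd_map {α : Type*} (P : N → N → F) (f : α → N) (l : List α) :
    chainProd P (l.map f) = chainProd (fun a b => P (f a) (f b)) l := by
  rw [chainProd, chainProd, ← List.map_tail, List.zipWith_map]

theorem isRotated_filter {α : Type*} (q : α → Bool) {l l' : List α} (h : l ~r l') :
    l.filter q ~r l'.filter q := by
  obtain ⟨m, hm, rfl⟩ := List.isRotated_iff_mod.mp h
  rw [List.rotate_eq_drop_append_take hm, List.filter_append]
  conv_lhs => rw [← List.take_append_drop m l, List.filter_append]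
  exact List.isRotated_append

theorem dedup_double {α : Type*} [DecidableEq α] (x : α) (l : List α) : ∀ l' : List α,
    (l' ++ x :: l).Nodup → (l' ++ x :: x :: l).dedup = l' ++ x :: l
  | [], h => by
      rw [List.nil_append] at h
      rw [List.nil_append, List.nil_append, List.dedup_cons_of_mem (by simp), h.dedup]
  | y :: l', h => by
      rw [List.cons_append, List.nodup_cons] at h
      rw [List.cons_append, List.dedup_cons_of_notMem, dedup_double x l l' h.2, List.cons_append]
      simpa using h.1

end ParkeTaylorFunctions

/-! ### Words and Plücker coordinates after identifying `i` and `j` -/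

section SideWords

variable {n : ℕ} [NeZero n] {F : Type} [Field F]

theorem toSide_of_mem {x y a : Fin n} (h : a ∈ openArc x y) : toSide x y a = some ⟨a, h⟩ := by
  rw [toSide, dif_pos h]

theorem toSide_of_notMem {x y a : Fin n} (h : a ∉ openArc x y) : toSide x y a = none := by
  rw [toSide, dif_neg h]

theorem start_notMem_openArc (x y : Fin n) : x ∉ openArc x y := by
  rw [mem_openArc, CycOrd]; omega

theorem end_notMem_openArc (x y : Fin n) : y ∉ openArc x y := by
  rw [mem_openArc, CycOrd]; omega

/-- Both `s` and `t` become `⋆`, so the chain `s v t` is the closed cycle `⋆ v`. -/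
theorem PT_sideWord (x y s t : Fin n) (hs : s ∉ openArc x y)
    (ht : t ∉ openArc x y) (P : Side x y → Side x y → F) {l v : List (Fin n)}
    (hv : ∀ a ∈ v, a ∈ openArc x y) (hnd : v.Nodup)
    (h : l.filter (fun a => decide (a ∈ closedArc x y)) ~r s :: (v ++ [t])) :
    PT P (sideWord x y l) =
      (chainProd (fun a b => P (toSide x y a) (toSide x y b)) (s :: (v ++ [t])))⁻¹ := by
  have hs' := toSide_of_notMem hs
  have ht' := toSide_of_notMem ht
  have hnone : ∀ w : List (Fin n), (∀ a ∈ w, a ∈ v) → none ∉ w.map (toSide x y) := by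
    intro w hw hm
    obtain ⟨a, ha, h⟩ := List.mem_map.mp hm
    rw [toSide_of_mem (hv a (hw a ha))] at h
    simp at h
  have hmapnd : (v.map (toSide x y)).Nodup := by
    refine List.Nodup.map_on ?_ hnd
    intro a ha b hb hab
    rw [toSide_of_mem (hv a ha), toSide_of_mem (hv b hb)] at hab
    simpa using hab
  have hgoal : (chainProd (fun a b => P (toSide x y a) (toSide x y b)) (s :: (v ++ [t])))⁻¹ =
      PT P (none :: v.map (toSide x y)) := by
    rw [PT_cons, ← chainProd_map P (toSide x y)]
    simp [hs', ht']
  rw [hgoal]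
  apply PT_eq_of_isRotated
  rw [sideWord]
  obtain ⟨m, hm, hrot⟩ := List.isRotated_iff_mod.mp h.symm
  rw [List.rotate_eq_drop_append_take hm] at hrot
  -- Depending on where the rotation cuts, the two copies of `⋆` are at the two ends of the word or
  -- adjacent inside it. In both cases `dedup` leaves a rotation of `⋆ v`.
  by_cases hm0 : m = 0 ∨ m = (s :: (v ++ [t])).length
  · have : l.filter (fun a => decide (a ∈ closedArc x y)) = s :: (v ++ [t]) := by
      rw [← hrot]
      rcases hm0 with rfl | rfl <;> simp
    rw [this, List.map_cons, List.map_append, List.map_singleton, hs', ht',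
      List.dedup_cons_of_mem (by simp), List.Nodup.dedup]
    · exact List.isRotated_append
    · rw [← List.concat_eq_append, List.nodup_concat]
      exact ⟨hnone v fun _ h => h, hmapnd⟩
  · push Not at hm0
    obtain ⟨m, rfl⟩ : ∃ m', m = m' + 1 := ⟨m - 1, by omega⟩
    have hmv : m ≤ v.length := by
      have : (s :: (v ++ [t])).length = v.length + 2 := by simp
      omega
    rw [List.drop_succ_cons, List.take_succ_cons, List.drop_append_of_le_length hmv,
      List.take_append_of_le_length hmv] at hrot
    have hperm : (v.drop m).map (toSide x y) ++ none :: (v.take m).map (toSide x y) ~r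
        none :: v.map (toSide x y) := by
      refine List.isRotated_append.trans ?_
      rw [List.cons_append, ← List.map_append, List.take_append_drop]
    have hnd' : (none :: v.map (toSide x y)).Nodup :=
      List.nodup_cons.mpr ⟨hnone v fun _ h => h, hmapnd⟩
    rw [← hrot]
    simp only [List.map_append, List.map_cons, hs', ht', List.append_assoc,
      List.singleton_append]
    rw [dedup_double]
    · exact hperm
    · exact hperm.nodup_iff.mpr hnd'

theorem chainProd_map_range {α : Type*} (p : α → α → F) (f : ℕ → α) : ∀ m : ℕ,
    chainProd p ((List.range (m + 1)).map f) = ∏ k ∈ Finset.range m, p (f k) (f (k + 1))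
  | 0 => by simp [chainProd]
  | m + 1 => by
      have h : (List.range (m + 1 + 1)).map f = (List.range m).map f ++ f m :: [f (m + 1)] := by
        simp [List.range_succ]
      rw [h, chainProd_append, Finset.prod_range_succ, ← chainProd_map_range p f m]
      congr 1
      · simp [List.range_succ]
      · simp [chainProd]

theorem prod_halfOpenArc (x y : Fin n) (f : Fin n → F) :
    ∏ c ∈ halfOpenArc x y, f c =
      ∏ k ∈ Finset.range (y - x).val, f (x + (Fin.ofNat n k)) := by
  symm
  have hlt := (y - x).isLt
  refine Finset.prod_bij' (fun k _ => x + Fin.ofNat n k) (fun c _ => (c - x).val) ?_ ?_ ?_ ?_ ?_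
  · intro k hk
    rw [Finset.mem_range] at hk
    simp only [halfOpenArc, Finset.mem_filter, Finset.mem_univ, true_and, add_sub_cancel_left,
      Fin.lt_def, Fin.val_ofNat]
    rwa [Nat.mod_eq_of_lt (by omega)]
  · intro c hc
    rw [halfOpenArc, Finset.mem_filter] at hc
    exact Finset.mem_range.mpr (Fin.lt_def.mp hc.2)
  · intro k hk
    rw [Finset.mem_range] at hk
    simp only [add_sub_cancel_left, Fin.val_ofNat]
    exact Nat.mod_eq_of_lt (by omega)
  · intro c _
    simp
  · intro k _
    rfl

theorem ofNat_add_one (k : ℕ) : Fin.ofNat n (k + 1) = Fin.ofNat n k + 1 := by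
  apply Fin.ext
  rw [Fin.val_add, Fin.val_ofNat, Fin.val_ofNat, Fin.val_one', Nat.add_mod]

theorem finRange_isRotated (x : Fin n) :
    List.finRange n ~r (List.range n).map fun k => x + Fin.ofNat n k := by
  refine ⟨x.val, ?_⟩
  apply List.ext_getElem
  · simp
  · intro k h1 h2
    rw [List.getElem_rotate, List.getElem_map, List.getElem_range]
    have hk : k < n := by simpa using h2
    apply Fin.ext
    rw [Fin.val_add, Fin.val_ofNat, Nat.mod_eq_of_lt hk]
    simp [Nat.add_comm]

/-- Rotated to begin at `x`, the word `1 2 … n` restricts to its initial segment `x, x + 1, …, y`.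
-/
theorem PT_identityWord {x y : Fin n} (hxy : x ≠ y) (P : Side x y → Side x y → F) :
    PT P (identityWord x y) =
      (∏ c ∈ halfOpenArc x y, P (toSide x y c) (toSide x y (c + 1)))⁻¹ := by
  have hlt := (y - x).isLt
  obtain ⟨m, hm⟩ : ∃ m, (y - x).val = m + 1 := by
    refine ⟨(y - x).val - 1, ?_⟩
    have : (y - x).val ≠ 0 := fun h => hxy (sub_eq_zero.mp (Fin.ext h)).symm
    omega
  set f : ℕ → Fin n := fun k => x + Fin.ofNat n k with hf
  have hfx : f 0 = x := by
    have : (Fin.ofNat n 0) = 0 := Fin.ext (by simp)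
    rw [hf]; simp only [this, add_zero]
  have hfval : ∀ k, k < n → (f k - x).val = k := fun k hk => by
    simp only [hf, add_sub_cancel_left, Fin.val_ofNat]; exact Nat.mod_eq_of_lt hk
  have hfy : f (m + 1) = y := by
    have : f (m + 1) - x = y - x := Fin.ext (by rw [hfval _ (by omega), hm])
    exact sub_left_injective this
  have hlist : (List.range (m + 1 + 1)).map f =
      x :: ((List.range m).map (fun k => f (k + 1)) ++ [y]) := by
    rw [List.range_succ_eq_map, List.map_cons, hfx, List.map_map, List.range_succ, List.map_append,
      List.map_singleton, Function.comp_apply, hfy]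
    rfl
  have hfilter : ((List.range n).map f).filter (fun a => decide (a ∈ closedArc x y)) =
      (List.range (m + 1 + 1)).map f := by
    have hmem : ∀ k, k < n → (f k ∈ closedArc x y ↔ k ≤ m + 1) := fun k hk => by
      simp only [closedArc, Finset.mem_filter, Finset.mem_univ, true_and, Fin.le_def]
      rw [hfval k hk, hm]
    obtain ⟨r, hr⟩ : ∃ r, n = m + 1 + 1 + r := ⟨n - (m + 2), by omega⟩
    have hrange : List.range n = List.range (m + 1 + 1) ++
        (List.range r).map (m + 1 + 1 + ·) := by
      conv_lhs => rw [hr]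
      exact List.range_add
    rw [hrange, List.map_append, List.filter_append, List.filter_eq_self.mpr,
      List.filter_eq_nil_iff.mpr, List.append_nil]
    · intro a ha
      simp only [List.mem_map, List.mem_range] at ha
      obtain ⟨_, ⟨k, hk, rfl⟩, rfl⟩ := ha
      rw [decide_eq_true_eq, hmem _ (by omega)]
      omega
    · intro a ha
      simp only [List.mem_map, List.mem_range] at ha
      obtain ⟨k, hk, rfl⟩ := ha
      rw [decide_eq_true_eq, hmem _ (by omega)]
      omega
  have hrot : (List.finRange n).filter (fun a => decide (a ∈ closedArc x y)) ~r
      x :: ((List.range m).map (fun k => f (k + 1)) ++ [y]) := by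
    rw [← hlist, ← hfilter]
    exact isRotated_filter _ (finRange_isRotated x)
  rw [identityWord, PT_sideWord x y x y (start_notMem_openArc x y) (end_notMem_openArc x y) P
    (v := (List.range m).map (fun k => f (k + 1))) ?_ ?_ hrot, ← hlist, chainProd_map_range,
    prod_halfOpenArc, hm]
  · congr 1
    refine Finset.prod_congr rfl fun k _ => ?_
    simp only [hf, ofNat_add_one, add_assoc]
  · intro a ha
    simp only [List.mem_map, List.mem_range] at ha
    obtain ⟨k, hk, rfl⟩ := ha
    simp only [openArc, Finset.mem_filter, Finset.mem_univ, true_and, Fin.lt_def]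
    rw [hfval _ (by omega), hm, Fin.val_zero]
    omega
  · refine List.Nodup.map_on ?_ List.nodup_range
    intro a ha b hb hab
    rw [List.mem_range] at ha hb
    have := congrArg (fun z => (z - x).val) hab
    simp only [hfval _ (show a + 1 < n by omega), hfval _ (show b + 1 < n by omega)] at this
    omega

theorem arcPlucker_toSide {x y s t : Fin n} (hxy : x ≠ y) (hends : s = x ∧ t = y ∨ s = y ∧ t = x)
    {P : Side x y → Side x y → F} (hanti : ∀ a b, P a b = -P b a) (hself : ∀ a, P a a = 0)
    (hpl : ∀ a b c d, P a b * P c d - P a c * P b d + P a d * P b c = 0)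
    (hne : ∀ a b, a ≠ b → P a b ≠ 0) :
    ArcPlucker x y s t fun a b => P (toSide x y a) (toSide x y b) where
  anti _ _ := hanti _ _
  plucker _ _ _ _ := hpl _ _ _ _
  ends := hends
  ne := hxy
  self_start := hself _
  end_start := by
    have h1 := toSide_of_notMem (start_notMem_openArc x y)
    have h2 := toSide_of_notMem (end_notMem_openArc x y)
    rcases hends with ⟨rfl, rfl⟩ | ⟨rfl, rfl⟩ <;> rw [h1, h2] <;> exact hself _
  ne_zero b hb a _ hab := by
    refine hne _ _ ?_
    rw [toSide_of_mem hb]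
    by_cases ha : a ∈ openArc x y
    · rw [toSide_of_mem ha]
      simpa using hab
    · rw [toSide_of_notMem ha]
      simp

end SideWords

/-! ### Plücker coordinates in the field of rational functions -/

section Plucker

variable {L R : Type}

theorem genericMinor_ne_zero {N : Type} {a b : N} (h : a ≠ b) :
    (genericMinor a b : MvPolynomial (Fin 2 × N) ℝ) ≠ 0 := by
  classical
  intro h0
  -- At the matrix with entries `1` in the places `(0, a)` and `(1, b)` only, the minor is `1`.
  have h1 := congrArg (MvPolynomial.eval fun z : Fin 2 × N =>
    if z = (0, a) ∨ z = (1, b) then (1 : ℝ) else 0) h0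
  simp [genericMinor, h] at h1

theorem genericMinor_anti {N : Type} (a b : N) : genericMinor a b = -genericMinor b a := by
  simp only [genericMinor]; ring

theorem genericMinor_self {N : Type} (a : N) : genericMinor a a = 0 := by
  simp only [genericMinor]; ring

theorem genericMinor_relation {N : Type} (a b c d : N) :
    genericMinor a b * genericMinor c d - genericMinor a c * genericMinor b d +
      genericMinor a d * genericMinor b c = 0 := by
  simp only [genericMinor]; ring

theorem map_eq_neg {A K : Type*} [CommRing A] [Field K] (f : A →+* K) {x y : A} (h : x = -y) :
    f x = -f y := by rw [h, map_neg]

theorem map_eq_zero_of_eq {A K : Type*} [CommRing A] [Field K] (f : A →+* K) {x : A} (h : x = 0) :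
    f x = 0 := by rw [h, map_zero]

theorem map_plucker_relation {A K : Type*} [CommRing A] [Field K] (f : A →+* K)
    {x₁ x₂ x₃ x₄ x₅ x₆ : A} (h : x₁ * x₂ - x₃ * x₄ + x₅ * x₆ = 0) :
    f x₁ * f x₂ - f x₃ * f x₄ + f x₅ * f x₆ = 0 := by
  rw [← map_mul, ← map_mul, ← map_mul, ← map_sub, ← map_add, h, map_zero]

theorem map_ne_zero_of_injective {A K : Type*} [CommRing A] [Field K] (f : A →+* K)
    (hf : Function.Injective f) {x : A} (h : x ≠ 0) : f x ≠ 0 := (map_ne_zero_iff f hf).mpr h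

theorem pluckerL_anti (a b : L) :
    (pluckerL a b : RatFun L R) = -(pluckerL b a : RatFun L R) :=
  map_eq_neg _ (Subtype.ext (genericMinor_anti _ _))

theorem pluckerL_self (a : L) : (pluckerL a a : RatFun L R) = 0 :=
  map_eq_zero_of_eq _ (Subtype.ext (genericMinor_self _))

theorem pluckerL_relation (a b c d : L) :
    (pluckerL a b : RatFun L R) * (pluckerL c d : RatFun L R) -
      (pluckerL a c : RatFun L R) * (pluckerL b d : RatFun L R) +
      (pluckerL a d : RatFun L R) * (pluckerL b c : RatFun L R) = 0 :=
  map_plucker_relation _ (Subtype.ext (genericMinor_relation _ _ _ _))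

theorem pluckerL_ne_zero {a b : L} (h : a ≠ b) : (pluckerL a b : RatFun L R) ≠ 0 :=
  map_ne_zero_of_injective _ (IsFractionRing.injective (coneRing L R) (RatFun L R))
    fun h0 => genericMinor_ne_zero (Sum.inl_injective.ne h) (congrArg Subtype.val h0)

theorem pluckerR_anti (a b : R) :
    (pluckerR a b : RatFun L R) = -(pluckerR b a : RatFun L R) :=
  map_eq_neg _ (Subtype.ext (genericMinor_anti _ _))

theorem pluckerR_self (a : R) : (pluckerR a a : RatFun L R) = 0 :=
  map_eq_zero_of_eq _ (Subtype.ext (genericMinor_self _))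

theorem pluckerR_relation (a b c d : R) :
    (pluckerR a b : RatFun L R) * (pluckerR c d : RatFun L R) -
      (pluckerR a c : RatFun L R) * (pluckerR b d : RatFun L R) +
      (pluckerR a d : RatFun L R) * (pluckerR b c : RatFun L R) = 0 :=
  map_plucker_relation _ (Subtype.ext (genericMinor_relation _ _ _ _))

theorem pluckerR_ne_zero {a b : R} (h : a ≠ b) : (pluckerR a b : RatFun L R) ≠ 0 :=
  map_ne_zero_of_injective _ (IsFractionRing.injective (coneRing L R) (RatFun L R))
    fun h0 => genericMinor_ne_zero (Sum.inr_injective.ne h) (congrArg Subtype.val h0)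

end Plucker

/-! ### Assembly of the weight function -/

section Main

variable {n : ℕ} [NeZero n]

/-- The filtered word of one side of the arc. -/
theorem filter_closedArc_isRotated {i j x y : Fin n} (hij : i ≠ j)
    (hxy : x = i ∧ y = j ∨ x = j ∧ y = i) {w : Equiv.Perm (Fin n)} {v : List (Fin n)}
    (hv : v ∈ words (openArc i j ∪ openArc j i))
    (h : List.ofFn (rotateTo w i) = j :: (v ++ [i])) :
    (List.ofFn w).filter (fun a => decide (a ∈ closedArc x y)) ~r
      j :: (v.filter (· ∈ openArc x y) ++ [i]) := by
  have hr := isRotated_filter (fun a => decide (a ∈ closedArc x y)) (ofFn_isRotated w i)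
  have hmem : ∀ a : Fin n, a ≠ i → a ≠ j → (a ∈ closedArc x y ↔ a ∈ openArc x y) := by
    intro a h1 h2
    have h0 := Fin.val_ne_of_ne hij
    have h1 := Fin.val_ne_of_ne h1
    have h2 := Fin.val_ne_of_ne h2
    rw [mem_closedArc, mem_openArc, CycOrd]
    rcases hxy with ⟨rfl, rfl⟩ | ⟨rfl, rfl⟩ <;> omega
  have hj : j ∈ closedArc x y := by
    rw [mem_closedArc]; rcases hxy with ⟨rfl, rfl⟩ | ⟨rfl, rfl⟩ <;> omega
  have hi : i ∈ closedArc x y := by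
    rw [mem_closedArc]; rcases hxy with ⟨rfl, rfl⟩ | ⟨rfl, rfl⟩ <;> omega
  have he : (j :: (v ++ [i])).filter (fun a => decide (a ∈ closedArc x y)) =
      j :: (v.filter (· ∈ openArc x y) ++ [i]) := by
    rw [List.filter_cons_of_pos (by simpa using hj), List.filter_append,
      List.filter_cons_of_pos (by simpa using hi), List.filter_nil]
    congr 2
    refine List.filter_congr fun a ha => ?_
    have ha := (mem_of_mem_words hv).mp ha
    rw [(openArc_union hij).2] at ha
    simp only [Finset.mem_sdiff, Finset.mem_univ, true_and, Finset.mem_insert,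
      Finset.mem_singleton, not_or] at ha
    simp only [hmem a ha.1 ha.2]
  rwa [h, he] at hr

theorem PT_sideWord_ofFn {F : Type} [Field F] {i j x y : Fin n} (hij : i ≠ j)
    (hxy : x = i ∧ y = j ∨ x = j ∧ y = i) {w : Equiv.Perm (Fin n)} {v : List (Fin n)}
    (hv : v ∈ words (openArc i j ∪ openArc j i))
    (h : List.ofFn (rotateTo w i) = j :: (v ++ [i])) (P : Side x y → Side x y → F) :
    PT P (sideWord x y (List.ofFn w)) =
      (chainProd (fun a b => P (toSide x y a) (toSide x y b))
        (j :: (v.filter (· ∈ openArc x y) ++ [i])))⁻¹ := by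
  refine PT_sideWord x y j i ?_ ?_ P ?_ ((mem_words.mp hv).1.filter _)
    (filter_closedArc_isRotated hij hxy hv h)
  · rcases hxy with ⟨rfl, rfl⟩ | ⟨rfl, rfl⟩
    exacts [end_notMem_openArc _ _, start_notMem_openArc _ _]
  · rcases hxy with ⟨rfl, rfl⟩ | ⟨rfl, rfl⟩
    exacts [start_notMem_openArc _ _, end_notMem_openArc _ _]
  · intro a ha
    simpa using (List.mem_filter.mp ha).2

theorem tileFacetWeight_eq {i j : Fin n} (hij : IsInternal i j) (σ : BicoloredSubdivision n)
    (hσ : σ.IsFacetDefining i j) :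
    tileFacetWeight σ i j =
      (-1) ^ (σ.numBlackTriangles - 1) *
        ((n - 2).choose (Fintype.card (Side i j) - 1) : RatFun (Side i j) (Side j i)) *
        PT pluckerL (identityWord i j) * PT pluckerR (identityWord j i) := by
  classical
  obtain ⟨P, hPb, hE⟩ := hσ
  have hP := σ.black_subset hPb
  -- As the arc is internal, a polygon lies on its other side; alternation of colours makes it
  -- white.
  obtain ⟨Q, hQ, hEQ⟩ := (σ.edge_glued P hP j i hE).resolve_left hij.2.2
  have hQw : Q ∉ σ.black := (σ.colors_alternate P hP Q hQ j i hE hEQ).mp hPb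
  set pL : Fin n → Fin n → RatFun (Side i j) (Side j i) :=
    fun a b => pluckerL (toSide i j a) (toSide i j b) with hpL
  set pR : Fin n → Fin n → RatFun (Side i j) (Side j i) :=
    fun a b => pluckerR (toSide j i a) (toSide j i b) with hpR
  -- Words run from `j` to `i` on both sides: from the end to the start of the arc on the left,
  -- which fits the black `P`, and from start to end on the right, which fits the white `Q`.
  have HL : ArcPlucker i j j i pL := arcPlucker_toSide hij.1 (Or.inr ⟨rfl, rfl⟩) pluckerL_anti
    pluckerL_self pluckerL_relation fun _ _ => pluckerL_ne_zero
  have HR : ArcPlucker j i j i pR := arcPlucker_toSide hij.1.symm (Or.inl ⟨rfl, rfl⟩)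
    pluckerR_anti pluckerR_self pluckerR_relation fun _ _ => pluckerR_ne_zero
  obtain ⟨hdisj, hunion⟩ := openArc_union hij.1
  have hweight : tileFacetWeight σ i j =
      ∑ v ∈ words (openArc i j ∪ openArc j i) with
        σ.Oriented i j (wordPos j i (v.filter (· ∈ openArc i j))) ∧
        σ.Oriented j i (wordPos j i (v.filter (· ∈ openArc j i))),
        (chainProd pL (j :: (v.filter (· ∈ openArc i j) ++ [i])))⁻¹ *
          (chainProd pR (j :: (v.filter (· ∈ openArc j i) ++ [i])))⁻¹ := by
    have hcond : ∀ w : Equiv.Perm (Fin n),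
        (w ∈ descentClass σ.numBlackTriangles n ∧ Precedes w i j ∧
          wFacet w i j ⊆ tileFacet σ i j) ↔
        (w (Fin.rev 0) = Fin.rev 0 ∧ Precedes w i j) ∧ σ.OrientedAll (permPos w) := by
      intro w
      rw [descentClass, Set.mem_ofPred_eq]
      constructor
      · rintro ⟨⟨h1, h2⟩, h3, h4⟩
        exact ⟨⟨h2, h3⟩, (facet_condition_iff hij hP hE h3).mp ⟨h1, h4⟩⟩
      · rintro ⟨⟨h2, h3⟩, h⟩
        have := (facet_condition_iff hij hP hE h3).mpr h
        exact ⟨⟨this.1, h2⟩, h3, this.2⟩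
    rw [tileFacetWeight, Finset.filter_congr fun w _ => hcond w]
    refine (Finset.sum_congr (by ext; simp only [Finset.mem_filter]) fun _ _ => rfl).trans
      ((sum_perm_eq_sum_words hij.1 (fun w => σ.OrientedAll (permPos w))
      (fun v => σ.Oriented i j (wordPos j i (v.filter (· ∈ openArc i j))) ∧
        σ.Oriented j i (wordPos j i (v.filter (· ∈ openArc j i))))
      (fun w => wFacetWeight w i j) _ ?_ ?_).trans
        (Finset.sum_congr (by ext; simp only [Finset.mem_filter]) fun _ _ => rfl))
    · intro w v hv h
      have hmem : ∀ x, x ∈ v ↔ x ≠ i ∧ x ≠ j := fun x => by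
        rw [mem_of_mem_words hv, hunion]; simp
      have hiv : i ∉ v := fun h => ((hmem i).mp h).1 rfl
      have hjv : j ∉ v := fun h => ((hmem j).mp h).2 rfl
      have hres : ∀ x y : Fin n, (x = i ∧ y = j ∨ x = j ∧ y = i) →
          (σ.Oriented x y (wordPos j i (v.filter (· ∈ openArc x y))) ↔
            σ.Oriented x y (wordPos j i v)) := by
        intro x y hxy
        have hcl : ∀ a ∈ closedArc x y, a ∈ openArc x y ∨ a = j ∨ a = i := by
          intro a ha
          rcases ArcPlucker.mem_closedArc_cases ha with h | h | h
          · exact Or.inl h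
          all_goals
            rcases hxy with ⟨h1, h2⟩ | ⟨h1, h2⟩ <;> simp_all
        exact BicoloredSubdivision.Oriented.congr fun a ha b hb =>
          wordPos_filter_lt hjv hiv (hcl a ha) (hcl b hb)
      rw [hres i j (Or.inl ⟨rfl, rfl⟩), hres j i (Or.inr ⟨rfl, rfl⟩), ← σ.orientedAll_iff hP hE,
        ← permPos_eq_wordPos h, orientedAll_rotateTo]
    · intro w v hv h
      rw [wFacetWeight, PT_sideWord_ofFn hij.1 (Or.inl ⟨rfl, rfl⟩) hv h,
        PT_sideWord_ofFn hij.1 (Or.inr ⟨rfl, rfl⟩) hv h]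
  have hL := HL.sum_oriented_side σ hP hE (by simp [hPb])
  have hR := HR.sum_oriented_side σ hQ hEQ (by simp [hQw, hij.1.symm])
  rw [if_pos hPb] at hL
  rw [if_neg hQw, add_zero] at hR
  have hsum := sum_words_union hdisj (fun v => σ.Oriented i j (wordPos j i v))
    (fun v => σ.Oriented j i (wordPos j i v)) (fun v => (chainProd pL (j :: (v ++ [i])))⁻¹)
    (fun v => (chainProd pR (j :: (v ++ [i])))⁻¹)
  have hL' : ∑ v ∈ words (openArc i j) with σ.Oriented i j (wordPos j i v),
      (chainProd pL (j :: (v ++ [i])))⁻¹ = _ :=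
    (Finset.sum_congr (by ext; simp only [Finset.mem_filter]) fun _ _ => rfl).trans hL
  have hR' : ∑ v ∈ words (openArc j i) with σ.Oriented j i (wordPos j i v),
      (chainProd pR (j :: (v ++ [i])))⁻¹ = _ :=
    (Finset.sum_congr (by ext; simp only [Finset.mem_filter]) fun _ _ => rfl).trans hR
  rw [hweight, hsum, hL', hR', PT_identityWord hij.1, PT_identityWord hij.1.symm]
  have hcardL : Fintype.card (Side i j) - 1 = (openArc i j).card := by
    rw [Fintype.card_option, Fintype.card_coe, Nat.add_sub_cancel]
  have hcard : n - 2 = (openArc i j).card + (openArc j i).card := by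
    rw [← Finset.card_union_of_disjoint hdisj, hunion, Finset.card_sdiff_of_subset
      (Finset.subset_univ _), Finset.card_univ, Fintype.card_fin, Finset.card_pair hij.1]
  -- The black polygon `P` contains a triangle, so the exponent `k - 1` is not truncated.
  have hk : 1 ≤ σ.numBlackTriangles := by
    have h1 := Finset.single_le_sum (f := fun P : Finset (Fin n) => P.card - 2)
      (fun _ _ => Nat.zero_le _) hPb
    have h2 := σ.three_le_card P hP
    have h3 : P.card - 2 ≤ σ.numBlackTriangles := h1
    omega
  -- The exponents of the two sides add up to `k + 1`, which has the parity of `k - 1`.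
  have hsign : ((-1 : RatFun (Side i j) (Side j i)) ^ (σ.numBlackTriangles - 1)) =
      (-1) ^ (σ.area i j + 1) * (-1) ^ σ.area j i := by
    rw [← pow_add]
    have h := σ.area_add_area hP hE
    rw [show σ.area i j + 1 + σ.area j i = (σ.numBlackTriangles - 1) + 2 by omega, pow_add,
      neg_one_sq, mul_one]
  rw [hcardL, hcard, hsign]
  ring

end Main

end

end ParkeTaylor

theorem mainTheorem12 (n k : ℕ) [NeZero n] (i j : Fin n) (hij : ParkeTaylor.IsInternal i j) :
    (∀ σ : ParkeTaylor.BicoloredSubdivision n,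
      σ.numBlackTriangles = k → σ.IsFacetDefining i j →
        ParkeTaylor.tileFacetWeight σ i j =
          (-1) ^ (k - 1) * ((n - 2).choose (Fintype.card (ParkeTaylor.Side i j) - 1) :
              ParkeTaylor.RatFun (ParkeTaylor.Side i j) (ParkeTaylor.Side j i)) *
            ParkeTaylor.PT ParkeTaylor.pluckerL (ParkeTaylor.identityWord i j) *
            ParkeTaylor.PT ParkeTaylor.pluckerR (ParkeTaylor.identityWord j i)) ∧
    (∀ σ τ : ParkeTaylor.BicoloredSubdivision n,
      σ.numBlackTriangles = k → τ.numBlackTriangles = k →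
      σ.IsFacetDefining i j → τ.IsFacetDefining i j →
        ParkeTaylor.tileFacetWeight σ i j = ParkeTaylor.tileFacetWeight τ i j) := by
  refine ⟨fun σ hσ h => ?_, fun σ τ hσ hτ h h' => ?_⟩
  · rw [ParkeTaylor.tileFacetWeight_eq hij σ h, hσ]
  · rw [ParkeTaylor.tileFacetWeight_eq hij σ h, ParkeTaylor.tileFacetWeight_eq hij τ h', hσ, hτ]
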